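/- Let $F$ be a field. Let $\Omega$ be a set with maps $s,t\colon\Omega\to\mathbb Z_+$, and let $A$ be an $\Omega$-algebra, that is, an $F$-vector space with linear maps $\omega_A\colon A^{\otimes s(\omega)}\to A^{\otimes t(\omega)}$, $\omega\in\Omega$, where $A^{\otimes 0}=F$. Let $V\subseteq\mathrm{End}_F(A)$ be a unital subalgebra that is closed in the finite topology, which is generated by the sets $\{f \mid f(a_1)=b_1,\dots,f(a_n)=b_n\}$, $a_i,b_i\in A$. A coaction of a bialgebra $B$ on $A$ is a linear map $\rho\colon A\to A\otimes B$, $\rho(a)=a_{(0)}\otimes a_{(1)}$, that makes $A$ a counital right $B$-comodule and satisfies $\rho_{t(\omega)}\circ\omega_A=(\omega_A\otimes\mathrm{id}_B)\circ\rho_{s(\omega)}$ for all $\omega\in\Omega$, where $\rho_n(a_1\otimes\dots\otimes a_n)=(a_1)_{(0)}\otimes\dots\otimes(a_n)_{(0)}\otimes(a_1)_{(1)}\cdots(a_n)_{(1)}$ and $\rho_0(\alpha)=\alpha 1_B$. Its cosupport is $\mathrm{cosupp}\,\rho=\{a\mapsto q(a_{(1)})a_{(0)} \mid q\in B^*\}\subseteq\mathrm{End}_F(A)$.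 A subspace $W\subseteq\mathrm{End}_F(A)$ is pointwise finite dimensional if $Wa=\{wa\mid w\in W\}$ is finite dimensional for every $a\in A$. A $V$-universal coacting bialgebra $\mathcal B^\square(A,V)$ is a bialgebra with a coaction $\rho_{A,V}\colon A\to A\otimes\mathcal B^\square(A,V)$, $\mathrm{cosupp}\,\rho_{A,V}\subseteq V$, such that for every bialgebra $B$ and every coaction $\rho\colon A\to A\otimes B$ with $\mathrm{cosupp}\,\rho\subseteq V$ there is a unique unital algebra homomorphism $\varphi\colon\mathcal B^\square(A,V)\to B$ with $(\mathrm{id}_A\otimes\varphi)\rho_{A,V}=\rho$, and this $\varphi$ is a bialgebra homomorphism. A $V$-universal coacting Hopf algebra $\mathcal H^\square(A,V)$ is a Hopf algebra with a coaction $\rho^{\mathbf{Hopf}}_{A,V}\colon A\to A\otimes\mathcal H^\square(A,V)$, $\mathrm{cosupp}\,\rho^{\mathbf{Hopf}}_{A,V}\subseteq V$, such that for every Hopf algebra $H$ and every coaction $\rho\colon A\to A\otimes H$ with $\mathrm{cosupp}\,\rho\subseteq V$ there is a unique Hopf algebra homomorphism $\varphi\colon\mathcal H^\square(A,V)\to H$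 with $(\mathrm{id}_A\otimes\varphi)\rho^{\mathbf{Hopf}}_{A,V}=\rho$. Then: 1. $\mathcal B^\square(A,V)$ exists if and only if the subalgebra of $\mathrm{End}_F(A)$ generated by $\mathrm{cosupp}\,\rho$ for all bialgebras $B$ and all coactions $\rho\colon A\to A\otimes B$ with $\mathrm{cosupp}\,\rho\subseteq V$ is pointwise finite dimensional. 2. $\mathcal H^\square(A,V)$ exists if and only if the subalgebra of $\mathrm{End}_F(A)$ generated by $\mathrm{cosupp}\,\rho$ for all Hopf algebras $H$ and all coactions $\rho\colon A\to A\otimes H$ with $\mathrm{cosupp}\,\rho\subseteq V$ is pointwise finite dimensional. -/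

import Mathlib

open scoped TensorProduct Topology

universe u v w

section LinearMaps

variable (F : Type*) [Field F] {A B Q : Type*} [AddCommGroup A] [Module F A]
  [AddCommGroup B] [Module F B] [AddCommGroup Q] [Module F Q]

/-- The finite topology on `Hom_F(A, B)`: it is generated by the sets
`{f | f a₁ = b₁, …, f aₙ = bₙ}`. -/
@[reducible] def finiteTopology (A B : Type*) [AddCommGroup A] [Module F A]
    [AddCommGroup B] [Module F B] : TopologicalSpace (A →ₗ[F] B) :=
  TopologicalSpace.generateFrom
    {U | ∃ (n : ℕ) (a : Fin n → A) (b : Fin n → B), U = {f | ∀ i, f (a i) = b i}}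

variable {F}

/-- A subspace `V` of `Hom_F(A, B)` is pointwise finite dimensional if `V a = {v a | v ∈ V}` is
finite dimensional for all `a`. -/
def PointwiseFiniteDimensional (V : Submodule F (A →ₗ[F] B)) : Prop :=
  ∀ a : A, FiniteDimensional F (V.map (LinearMap.applyₗ a : (A →ₗ[F] B) →ₗ[F] B))

/-- For `ρ : A → B ⊗ Q`, `ρ a = ∑ a₀ ⊗ a₁`, the map `Q* → Hom_F(A, B)` that takes `q` to
`a ↦ ∑ q(a₁) a₀`. -/
noncomputable def coactDual (ρ : A →ₗ[F] B ⊗[F] Q) : Module.Dual F Q →ₗ[F] A →ₗ[F] B :=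
  LinearMap.lcomp F B ρ ∘ₗ (TensorProduct.rid F B).toLinearMap.compRight F ∘ₗ
    LinearMap.lTensorHom B

theorem coactDual_apply (ρ : A →ₗ[F] B ⊗[F] Q) (q : Module.Dual F Q) (a : A) :
    coactDual ρ q a = TensorProduct.rid F B (q.lTensor B (ρ a)) := rfl

/-- The cosupport of `ρ : A → B ⊗ Q`. -/
noncomputable def cosupport (ρ : A →ₗ[F] B ⊗[F] Q) : Submodule F (A →ₗ[F] B) :=
  LinearMap.range (coactDual ρ)

end LinearMaps

section OmegaAlgebras

/-- The structure of an `Ω`-algebra on a vector space `A`, where `Ω` is a set with source and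
target maps `s`, `t` to the natural numbers: linear maps `A^{⊗ s ω} → A^{⊗ t ω}`. -/
structure OmegaAlgebra (F : Type*) [Field F] {Ω : Type*} (s t : Ω → ℕ)
    (A : Type*) [AddCommGroup A] [Module F A] where
  op : ∀ ω : Ω, (⨂[F]^(s ω) A) →ₗ[F] (⨂[F]^(t ω) A)

variable {F : Type*} [Field F] {A B Q : Type*} [AddCommGroup A] [Module F A]
  [AddCommGroup B] [Module F B] [Ring Q] [Algebra F Q]

/-- `b ⊗ (b₁ ⊗ ⋯ ⊗ bₙ) ↦ b ⊗ b₁ ⊗ ⋯ ⊗ bₙ`. -/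
noncomputable def tensorPowerCons (F B : Type*) [Field F] [AddCommGroup B] [Module F B] (n : ℕ) :
    B →ₗ[F] (⨂[F]^n B) →ₗ[F] (⨂[F]^(n + 1) B) :=
  (PiTensorProduct.lift (R := F) (s := fun _ : Fin n => B)).toLinearMap ∘ₗ
    (PiTensorProduct.tprod F (s := fun _ : Fin (n + 1) => B)).curryLeft

/-- The multilinear map `(B ⊗ Q)ⁿ → B^{⊗ n} ⊗ Q` that takes `(b₁ ⊗ q₁, …, bₙ ⊗ qₙ)` to
`(b₁ ⊗ ⋯ ⊗ bₙ) ⊗ q₁ ⋯ qₙ`, see `collect_tmul`. -/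
noncomputable def collect (F B Q : Type*) [Field F] [AddCommGroup B] [Module F B] [Ring Q]
    [Algebra F Q] : ∀ n : ℕ, MultilinearMap F (fun _ : Fin n => B ⊗[F] Q) ((⨂[F]^n B) ⊗[F] Q)
  | 0 => MultilinearMap.constOfIsEmpty F _
      (PiTensorProduct.tprod F (fun i : Fin 0 => i.elim0) ⊗ₜ[F] (1 : Q))
  | n + 1 => LinearMap.uncurryLeft (M := fun _ : Fin (n + 1) => B ⊗[F] Q)
      { toFun := fun x => (TensorProduct.map₂ (tensorPowerCons F B n)
          (LinearMap.mul F Q) x).compMultilinearMap (collect F B Q n)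
        map_add' := fun x y => by ext m; simp
        map_smul' := fun c x => by ext m; simp }

theorem collect_tmul (n : ℕ) (b : Fin n → B) (q : Fin n → Q) :
    collect F B Q n (fun i => b i ⊗ₜ[F] q i) =
      PiTensorProduct.tprod F b ⊗ₜ[F] (List.ofFn q).prod := by
  induction n with
  | zero =>
    simp only [collect, MultilinearMap.constOfIsEmpty_apply, List.ofFn_zero, List.prod_nil]
    rw [Subsingleton.elim (fun i : Fin 0 => (i.elim0 : B)) b]
    rfl
  | succ n ih =>
    have h : collect F B Q (n + 1) (fun i => b i ⊗ₜ[F] q i) =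
        TensorProduct.map₂ (tensorPowerCons F B n) (LinearMap.mul F Q) (b 0 ⊗ₜ[F] q 0)
          (collect F B Q n (fun i => b i.succ ⊗ₜ[F] q i.succ)) := rfl
    rw [h, ih, TensorProduct.map₂_apply_tmul, TensorProduct.map_tmul, List.ofFn_succ,
      List.prod_cons]
    congr 1
    simp only [tensorPowerCons, LinearMap.comp_apply, LinearEquiv.coe_coe,
      PiTensorProduct.lift.tprod]
    exact congrArg (PiTensorProduct.tprod F) (Fin.cons_self_tail b)

/-- The map `ρₙ : A^{⊗ n} → B^{⊗ n} ⊗ Q` induced by `ρ : A → B ⊗ Q`,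
`ρₙ (a₁ ⊗ ⋯ ⊗ aₙ) = (a₁)₀ ⊗ ⋯ ⊗ (aₙ)₀ ⊗ (a₁)₁ ⋯ (aₙ)₁`. -/
noncomputable def inducedCoact (ρ : A →ₗ[F] B ⊗[F] Q) (n : ℕ) :
    (⨂[F]^n A) →ₗ[F] (⨂[F]^n B) ⊗[F] Q :=
  PiTensorProduct.lift ((collect F B Q n).compLinearMap fun _ => ρ)

/-- `ρ : A → B ⊗ Q` is a comeasuring of `Ω`-algebras: it preserves all operations. -/
def IsComeasuring {Ω : Type*} {s t : Ω → ℕ} (SA : OmegaAlgebra F s t A) (SB : OmegaAlgebra F s t B)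
    (ρ : A →ₗ[F] B ⊗[F] Q) : Prop :=
  ∀ ω : Ω, inducedCoact ρ (t ω) ∘ₗ SA.op ω = (SB.op ω).rTensor Q ∘ₗ inducedCoact ρ (s ω)

end OmegaAlgebras

section Coactions

variable {F : Type u} [Field F] {Ω : Type w} {s t : Ω → ℕ} {A : Type v} [AddCommGroup A]
  [Module F A]

/-- `ρ : A → A ⊗ B` is a coaction of the bialgebra `B` on the `Ω`-algebra `A`: it is
coassociative, counital, and a comeasuring. -/
structure IsCoaction (S : OmegaAlgebra F s t A) {B : Type*} [Ring B] [Bialgebra F B]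
    (ρ : A →ₗ[F] A ⊗[F] B) : Prop where
  coassoc : (TensorProduct.assoc F A B B).toLinearMap ∘ₗ ρ.rTensor B ∘ₗ ρ =
    (Coalgebra.comul (R := F) (A := B)).lTensor A ∘ₗ ρ
  counit : (TensorProduct.rid F A).toLinearMap ∘ₗ
    (Coalgebra.counit (R := F) (A := B)).lTensor A ∘ₗ ρ = LinearMap.id
  comeasuring : IsComeasuring S S ρ

/-- `ρ : A → A ⊗ B` is a `V`-universal bialgebra coaction on `A`: its cosupport lies in `V`, and
every bialgebra coaction with cosupport in `V` is obtained from it through a unique algebra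
homomorphism, which moreover is a bialgebra homomorphism. -/
structure IsUniversalBialgebraCoaction (S : OmegaAlgebra F s t A)
    (V : Subalgebra F (Module.End F A)) {B : Type (max u v)} [Ring B] [Bialgebra F B]
    (ρ : A →ₗ[F] A ⊗[F] B) : Prop where
  isCoaction : IsCoaction S ρ
  cosupport_le : cosupport ρ ≤ Subalgebra.toSubmodule V
  universal : ∀ (B' : Type (max u v)) [Ring B'] [Bialgebra F B'] (ρ' : A →ₗ[F] A ⊗[F] B'),
    IsCoaction S ρ' → cosupport ρ' ≤ Subalgebra.toSubmodule V →
      ∃ φ : B →ₐc[F] B', (φ : B →ₗ[F] B').lTensor A ∘ₗ ρ = ρ' ∧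
        ∀ ψ : B →ₐ[F] B', ψ.toLinearMap.lTensor A ∘ₗ ρ = ρ' → ψ = (φ : B →ₐ[F] B')

/-- The `V`-universal coacting bialgebra of `A` exists. -/
def UniversalCoactingBialgebraExists (S : OmegaAlgebra F s t A)
    (V : Subalgebra F (Module.End F A)) : Prop :=
  ∃ (B : Type (max u v)) (_ : Ring B) (_ : Bialgebra F B) (ρ : A →ₗ[F] A ⊗[F] B),
    IsUniversalBialgebraCoaction S V ρ

/-- `ρ : A → A ⊗ H` is a `V`-universal Hopf algebra coaction on `A`. A homomorphism of Hopf
algebras is a homomorphism of bialgebras, which automatically preserves the antipodes. -/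
structure IsUniversalHopfCoaction (S : OmegaAlgebra F s t A)
    (V : Subalgebra F (Module.End F A)) {H : Type (max u v)} [Ring H] [HopfAlgebra F H]
    (ρ : A →ₗ[F] A ⊗[F] H) : Prop where
  isCoaction : IsCoaction S ρ
  cosupport_le : cosupport ρ ≤ Subalgebra.toSubmodule V
  universal : ∀ (H' : Type (max u v)) [Ring H'] [HopfAlgebra F H'] (ρ' : A →ₗ[F] A ⊗[F] H'),
    IsCoaction S ρ' → cosupport ρ' ≤ Subalgebra.toSubmodule V →
      ∃! φ : H →ₐc[F] H', (φ : H →ₗ[F] H').lTensor A ∘ₗ ρ = ρ'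

/-- The `V`-universal coacting Hopf algebra of `A` exists. -/
def UniversalCoactingHopfAlgebraExists (S : OmegaAlgebra F s t A)
    (V : Subalgebra F (Module.End F A)) : Prop :=
  ∃ (H : Type (max u v)) (_ : Ring H) (_ : HopfAlgebra F H) (ρ : A →ₗ[F] A ⊗[F] H),
    IsUniversalHopfCoaction S V ρ

/-- The subalgebra of `End_F(A)` generated by the cosupports of all bialgebra coactions on `A`
with cosupport in `V`. -/
def bialgebraCosupportAlgebra (S : OmegaAlgebra F s t A) (V : Subalgebra F (Module.End F A)) :
    Subalgebra F (Module.End F A) :=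
  Algebra.adjoin F {f | ∃ (B : Type (max u v)) (_ : Ring B) (_ : Bialgebra F B)
    (ρ : A →ₗ[F] A ⊗[F] B),
      IsCoaction S ρ ∧ cosupport ρ ≤ Subalgebra.toSubmodule V ∧ f ∈ cosupport ρ}

/-- The subalgebra of `End_F(A)` generated by the cosupports of all Hopf algebra coactions on `A`
with cosupport in `V`. -/
def hopfCosupportAlgebra (S : OmegaAlgebra F s t A) (V : Subalgebra F (Module.End F A)) :
    Subalgebra F (Module.End F A) :=
  Algebra.adjoin F {f | ∃ (H : Type (max u v)) (_ : Ring H) (_ : HopfAlgebra F H)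
    (ρ : A →ₗ[F] A ⊗[F] H),
      IsCoaction S ρ ∧ cosupport ρ ≤ Subalgebra.toSubmodule V ∧ f ∈ cosupport ρ}

end Coactions

/-! Necessity: every admissible coaction is `(id ⊗ φ) ρ` for the universal `ρ`, so its cosupport
lies in that of `ρ`. The latter is already a subalgebra, by coassociativity and counitality, and it
is pointwise finite dimensional because each `ρ a` is a finite sum of pure tensors.

Sufficiency: let `W` be the closure of the generated subalgebra in the finite topology. It stays
inside the closed `V`, and closing up does not enlarge any `W a`. Pair `W` with `A* ⊗ A` by `λ(w a)`
and let `C` be `A* ⊗ A` modulo the annihilator of `W`. Since each `W a` is finite dimensional, there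
is a map `A → A ⊗ C` with the tautological coefficients (`exists_coactCoeff_eq_coeffMk`). Since `W`
is closed, a double annihilator argument puts its cosupport in `W` (`mem_of_coeffPairing_eq_zero`).
Linear maps out of `C` then classify the maps `A → A ⊗ Q` with cosupport in `W`. Dividing the tensor
algebra of `C` by the relations that preserve the operations gives the universal comeasuring
algebra. The composite of its comeasuring with itself still has cosupport in `W`
(`cosupport_coactComp_le`) and induces the comultiplication; the trivial coaction induces the
counit.

In the Hopf case the same `W`-universal bialgebra, with `W` built from Hopf coactions only, is
replaced by its Hopf envelope: the universal algebra with a chain `g₀, h₀, g₁, h₁, …` of successive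
convolution inverses. Such a chain is determined by `g₀` (`AntipodeChain.ext_zero`), and tensoring
chains, the counit chain and the shift yield the Hopf structure. -/

/-! ### Closure in the finite topology. -/

section FiniteClosure

variable {F : Type*} [Field F] {A : Type*} [AddCommGroup A] [Module F A]

/-- A subalgebra of `End_F(A)` is finitely closed if it contains every endomorphism that agrees on
each finite set with one of its members. -/
def IsFinitelyClosed (W : Subalgebra F (Module.End F A)) : Prop :=
  ∀ f : Module.End F A, (∀ S : Finset A, ∃ w ∈ W, ∀ a ∈ S, w a = f a) → f ∈ W

/-- Two finite lists of conditions can be concatenated, so the generating sets are closed under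
intersection. -/
theorem isTopologicalBasis_finiteTopology :
    @TopologicalSpace.IsTopologicalBasis _ (finiteTopology F A A)
      {U | ∃ (n : ℕ) (a : Fin n → A) (b : Fin n → A), U = {f | ∀ i, f (a i) = b i}} := by
  let := finiteTopology F A A
  refine ⟨?_, ?_, rfl⟩
  · rintro _ ⟨n, a, b, rfl⟩ _ ⟨m, c, d, rfl⟩ f ⟨hf, hg⟩
    refine ⟨_, ⟨n + m, Fin.append a c, Fin.append b d, rfl⟩, ?_, ?_⟩
    · intro i
      refine Fin.addCases (fun i => ?_) (fun i => ?_) i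
      · simpa using hf i
      · simpa using hg i
    · intro g hg
      exact ⟨fun i => by simpa using hg (Fin.castAdd m i), fun i => by simpa using hg (Fin.natAdd n i)⟩
  · refine Set.eq_univ_of_forall fun f => ?_
    exact ⟨_, ⟨0, Fin.elim0, Fin.elim0, rfl⟩, fun i => i.elim0⟩

theorem isFinitelyClosed_of_isClosed (V : Subalgebra F (Module.End F A))
    (hV : IsClosed[finiteTopology F A A] (V : Set (Module.End F A))) : IsFinitelyClosed V := by
  let := finiteTopology F A A
  intro f hf
  by_contra hfV
  obtain ⟨_, ⟨n, a, b, rfl⟩, hfb, hdisj⟩ :=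
    isTopologicalBasis_finiteTopology.exists_subset_of_mem_open
      (show f ∈ (V : Set (Module.End F A))ᶜ from hfV) hV.isOpen_compl
  classical
  obtain ⟨w, hw, hwf⟩ := hf (Finset.univ.image a)
  refine hdisj (a := w) (fun i => ?_) hw
  rw [hwf _ (Finset.mem_image_of_mem a (Finset.mem_univ i)), hfb i]

/-- The smallest finitely closed subalgebra that contains `W`. -/
def finiteClosure (W : Subalgebra F (Module.End F A)) : Subalgebra F (Module.End F A) where
  carrier := {f | ∀ S : Finset A, ∃ w ∈ W, ∀ a ∈ S, w a = f a}
  mul_mem' := by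
    intro f g hf hg S
    classical
    obtain ⟨w, hw, hwg⟩ := hg S
    -- The left factor only has to be approximated on the image of `S` under the right one.
    obtain ⟨w', hw', hwf⟩ := hf (S.image g)
    refine ⟨w' * w, mul_mem hw' hw, fun a ha => ?_⟩
    rw [Module.End.mul_apply, hwg a ha, hwf _ (Finset.mem_image_of_mem g ha), Module.End.mul_apply]
  add_mem' := by
    intro f g hf hg S
    obtain ⟨w, hw, hwf⟩ := hf S
    obtain ⟨w', hw', hwg⟩ := hg S
    exact ⟨w + w', add_mem hw hw', fun a ha => by simp [hwf a ha, hwg a ha]⟩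
  algebraMap_mem' r S := ⟨_, W.algebraMap_mem r, fun _ _ => rfl⟩

variable {W V : Subalgebra F (Module.End F A)}

theorem le_finiteClosure : W ≤ finiteClosure W := fun f hf _ => ⟨f, hf, fun _ _ => rfl⟩

theorem finiteClosure_le (hV : IsFinitelyClosed V) (h : W ≤ V) : finiteClosure W ≤ V :=
  fun f hf => hV f fun S => (hf S).imp fun _ hw => ⟨h hw.1, hw.2⟩

theorem isFinitelyClosed_finiteClosure : IsFinitelyClosed (finiteClosure W) := by
  intro f hf S
  obtain ⟨g, hg, hgf⟩ := hf S
  obtain ⟨w, hw, hwg⟩ := hg S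
  exact ⟨w, hw, fun a ha => (hwg a ha).trans (hgf a ha)⟩

/-- Approximation on the single point `a` shows that the closure has the same values at `a`. -/
theorem pointwiseFiniteDimensional_finiteClosure
    (hW : PointwiseFiniteDimensional (Subalgebra.toSubmodule W)) :
    PointwiseFiniteDimensional (Subalgebra.toSubmodule (finiteClosure W)) := by
  intro a
  have := hW a
  refine Submodule.finiteDimensional_of_le (S₂ := (Subalgebra.toSubmodule W).map
    (LinearMap.applyₗ a : (A →ₗ[F] A) →ₗ[F] A)) ?_
  rintro _ ⟨f, hf, rfl⟩
  obtain ⟨w, hw, hwf⟩ := hf {a}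
  exact ⟨w, hw, hwf a (by simp)⟩

theorem PointwiseFiniteDimensional.mono {B : Type*} [AddCommGroup B] [Module F B]
    {V W : Submodule F (A →ₗ[F] B)} (hW : PointwiseFiniteDimensional W)
    (h : V ≤ W) : PointwiseFiniteDimensional V := fun a =>
  have := hW a
  Submodule.finiteDimensional_of_le (Submodule.map_mono h)

end FiniteClosure

/-! ### Cosupports and their behaviour under composition. -/

section Cosupport

variable {F : Type*} [Field F] {A B Q R : Type*} [AddCommGroup A] [Module F A]
  [AddCommGroup B] [Module F B] [AddCommGroup Q] [Module F Q] [AddCommGroup R] [Module F R]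

theorem coactDual_mem_cosupport (ρ : A →ₗ[F] B ⊗[F] Q) (q : Module.Dual F Q) :
    coactDual ρ q ∈ cosupport ρ := ⟨q, rfl⟩

theorem finiteDimensional_slices (x : B ⊗[F] Q) :
    ∃ M : Submodule F B, FiniteDimensional F M ∧
      ∀ q : Module.Dual F Q, TensorProduct.rid F B (q.lTensor B x) ∈ M := by
  induction x with
  | zero => exact ⟨⊥, inferInstance, by simp⟩
  | tmul b c =>
    refine ⟨F ∙ b, inferInstance, fun q => ?_⟩
    simpa using Submodule.smul_mem _ _ (Submodule.mem_span_singleton_self b)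
  | add x y hx hy =>
    obtain ⟨M, _, hM⟩ := hx
    obtain ⟨N, _, hN⟩ := hy
    refine ⟨M ⊔ N, inferInstance, fun q => ?_⟩
    simpa using Submodule.add_mem_sup (hM q) (hN q)

theorem pointwiseFiniteDimensional_cosupport (ρ : A →ₗ[F] B ⊗[F] Q) :
    PointwiseFiniteDimensional (cosupport ρ) := by
  intro a
  obtain ⟨M, _, hM⟩ := finiteDimensional_slices (ρ a)
  refine Submodule.finiteDimensional_of_le (S₂ := M) ?_
  rintro _ ⟨_, ⟨q, rfl⟩, rfl⟩
  exact hM q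

theorem coactDual_lTensor_comp (ρ : A →ₗ[F] B ⊗[F] Q) (φ : Q →ₗ[F] R) (r : Module.Dual F R) :
    coactDual (φ.lTensor B ∘ₗ ρ) r = coactDual ρ (r ∘ₗ φ) := by
  ext a
  simp [coactDual_apply, LinearMap.lTensor_comp]

theorem cosupport_lTensor_comp_le (ρ : A →ₗ[F] B ⊗[F] Q) (φ : Q →ₗ[F] R) :
    cosupport (φ.lTensor B ∘ₗ ρ) ≤ cosupport ρ := by
  rintro _ ⟨r, rfl⟩
  rw [coactDual_lTensor_comp]
  exact coactDual_mem_cosupport _ _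

/-- The composite `(ρ ⊗ id) σ : A → A ⊗ (Q ⊗ R)` of `σ : A → A ⊗ R` and `ρ : A → A ⊗ Q`. -/
noncomputable def coactComp (ρ : A →ₗ[F] A ⊗[F] Q) (σ : A →ₗ[F] A ⊗[F] R) :
    A →ₗ[F] A ⊗[F] (Q ⊗[F] R) :=
  (TensorProduct.assoc F A Q R).toLinearMap ∘ₗ ρ.rTensor R ∘ₗ σ

/-- Composing coactions corresponds to multiplying slices in `End_F(A)`; with coassociativity this
makes the cosupport of a coaction closed under products. -/
theorem coactDual_coactComp (ρ : A →ₗ[F] A ⊗[F] Q) (σ : A →ₗ[F] A ⊗[F] R) (q : Module.Dual F Q)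
    (r : Module.Dual F R) :
    coactDual (coactComp ρ σ) (LinearMap.mul' F F ∘ₗ TensorProduct.map q r) =
      coactDual ρ q * coactDual σ r := by
  ext a
  simp only [Module.End.mul_apply, coactDual_apply, coactComp, LinearMap.comp_apply]
  induction σ a with
  | zero => simp
  | add x y hx hy => simp only [map_add, hx, hy]
  | tmul b c =>
    simp only [LinearMap.rTensor_tmul, LinearMap.lTensor_tmul, TensorProduct.rid_tmul, map_smul]
    induction ρ b with
    | zero => simp
    | add x y hx hy => simp only [map_add, hx, hy, TensorProduct.add_tmul, smul_add]
    | tmul d e => simp [smul_smul, mul_comm]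

/-- A functional on `Q ⊗ R` need not be a finite sum of products of functionals, so its slice need
not be a finite sum of products of slices. On a finite set of vectors it agrees with such a sum, and
finite closedness does the rest. -/
theorem cosupport_coactComp_le {W : Subalgebra F (Module.End F A)} (hW : IsFinitelyClosed W)
    {ρ : A →ₗ[F] A ⊗[F] Q} {σ : A →ₗ[F] A ⊗[F] R}
    (hρ : cosupport ρ ≤ Subalgebra.toSubmodule W) (hσ : cosupport σ ≤ Subalgebra.toSubmodule W) :
    cosupport (coactComp ρ σ) ≤ Subalgebra.toSubmodule W := by
  rintro _ ⟨p, rfl⟩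
  refine hW _ fun S => ?_
  classical
  let b := Module.Free.chooseBasis F R
  -- The finitely many basis vectors of `R` that occur in `σ a` for some `a ∈ S`.
  let J := S.biUnion fun a => (TensorProduct.equivFinsuppOfBasisRight b (σ a)).support
  refine ⟨∑ j ∈ J, coactDual ρ (p ∘ₗ (TensorProduct.mk F Q R).flip (b j)) *
    coactDual σ (b.coord j), sum_mem fun j _ => mul_mem (hρ (coactDual_mem_cosupport _ _))
      (hσ (coactDual_mem_cosupport _ _)), fun a ha => ?_⟩
  have h1 : σ a = ∑ j ∈ J, (coactDual σ (b.coord j) a) ⊗ₜ[F] b j := by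
    conv_lhs => rw [← (TensorProduct.equivFinsuppOfBasisRight b).symm_apply_apply (σ a),
      TensorProduct.equivFinsuppOfBasisRight_symm_apply]
    rw [Finsupp.sum_of_support_subset (s := J) _
      (Finset.subset_biUnion_of_mem (fun a =>
        (TensorProduct.equivFinsuppOfBasisRight b (σ a)).support) ha) _ (by simp)]
    refine Finset.sum_congr rfl fun j _ => ?_
    rw [TensorProduct.equivFinsuppOfBasisRight_apply]
    rfl
  have h2 : ∀ (c : A) (r : R), TensorProduct.rid F A (p.lTensor A
      (TensorProduct.assoc F A Q R (ρ.rTensor R (c ⊗ₜ r)))) =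
      coactDual ρ (p ∘ₗ (TensorProduct.mk F Q R).flip r) c := by
    intro c r
    rw [coactDual_apply, LinearMap.rTensor_tmul]
    induction ρ c with
    | zero => simp
    | add x y hx hy => simp only [map_add, hx, hy, TensorProduct.add_tmul]
    | tmul d e => simp
  rw [LinearMap.sum_apply, coactDual_apply, coactComp, LinearMap.comp_apply, LinearMap.comp_apply]
  rw [h1]
  simp only [map_sum]
  refine Finset.sum_congr rfl fun j _ => ?_
  exact (h2 _ _).symm

end Cosupport

/-! ### Compatibility of comeasurings with algebra maps and composition. -/

section Comeasuring

variable {F : Type*} [Field F] {Ω : Type*} {s t : Ω → ℕ} {A B Q R : Type*} [AddCommGroup A]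
  [Module F A] [AddCommGroup B] [Module F B] [Ring Q] [Algebra F Q] [Ring R] [Algebra F R]

theorem inducedCoact_tprod (ρ : A →ₗ[F] B ⊗[F] Q) (n : ℕ) (a : Fin n → A) :
    inducedCoact ρ n (PiTensorProduct.tprod F a) = collect F B Q n (fun i => ρ (a i)) := by
  simp [inducedCoact]

theorem multilinearMap_tensorProduct_ext {M : Type*} [AddCommGroup M] [Module F M] {n : ℕ}
    {f g : MultilinearMap F (fun _ : Fin n => A ⊗[F] B) M}
    (h : ∀ (a : Fin n → A) (b : Fin n → B),
      f (fun i => a i ⊗ₜ b i) = g (fun i => a i ⊗ₜ b i)) : f = g := by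
  let bA := Module.Free.chooseBasis F A
  let bB := Module.Free.chooseBasis F B
  refine Module.Basis.ext_multilinear (fun _ => bA.tensorProduct bB) fun v => ?_
  simpa only [Module.Basis.tensorProduct_apply'] using
    h (fun i => bA (v i).1) (fun i => bB (v i).2)

theorem List.prod_ofFn_tmul {n : ℕ} (q : Fin n → Q) (r : Fin n → R) :
    (List.ofFn fun i => q i ⊗ₜ[F] r i).prod = (List.ofFn q).prod ⊗ₜ[F] (List.ofFn r).prod := by
  induction n with
  | zero => simp [Algebra.TensorProduct.one_def]
  | succ n ih => simp [List.ofFn_succ, ih]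

theorem collect_lTensor (φ : Q →ₐ[F] R) (n : ℕ) (x : Fin n → B ⊗[F] Q) :
    collect F B R n (fun i => φ.toLinearMap.lTensor B (x i)) =
      φ.toLinearMap.lTensor _ (collect F B Q n x) := by
  have h : (collect F B R n).compLinearMap (fun _ => φ.toLinearMap.lTensor B) =
      (φ.toLinearMap.lTensor _).compMultilinearMap (collect F B Q n) := by
    refine multilinearMap_tensorProduct_ext fun b q => ?_
    have : (List.ofFn fun i => φ (q i)).prod = φ (List.ofFn q).prod := by
      rw [map_list_prod, List.map_ofFn]; rfl
    simp only [MultilinearMap.compLinearMap_apply, LinearMap.compMultilinearMap_apply,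
      LinearMap.lTensor_tmul, collect_tmul, AlgHom.toLinearMap_apply, this]
  exact congrArg (fun f => f x) h

theorem inducedCoact_lTensor_comp (φ : Q →ₐ[F] R) (ρ : A →ₗ[F] B ⊗[F] Q) (n : ℕ) :
    inducedCoact (φ.toLinearMap.lTensor B ∘ₗ ρ) n =
      φ.toLinearMap.lTensor _ ∘ₗ inducedCoact ρ n := by
  ext a
  simp only [LinearMap.compMultilinearMap_apply, LinearMap.comp_apply, inducedCoact_tprod,
    collect_lTensor]

/-- Multilinearity is used twice: first to reduce to pure tensors `a ⊗ r`, then, with `r` fixed, to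
treat each `ρ (a i)` as a pure tensor. -/
theorem collect_rTensor_assoc (ρ : A →ₗ[F] B ⊗[F] Q) (n : ℕ) (x : Fin n → A ⊗[F] R) :
    collect F B (Q ⊗[F] R) n (fun i => TensorProduct.assoc F B Q R (ρ.rTensor R (x i))) =
      TensorProduct.assoc F _ Q R ((inducedCoact ρ n).rTensor R (collect F A R n x)) := by
  have h : (collect F B (Q ⊗[F] R) n).compLinearMap
        (fun _ => (TensorProduct.assoc F B Q R).toLinearMap ∘ₗ ρ.rTensor R) =
      ((TensorProduct.assoc F _ Q R).toLinearMap ∘ₗ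
        (inducedCoact ρ n).rTensor R).compMultilinearMap (collect F A R n) := by
    refine multilinearMap_tensorProduct_ext fun a r => ?_
    have h' : (collect F B (Q ⊗[F] R) n).compLinearMap
        (fun i => (TensorProduct.assoc F B Q R).toLinearMap ∘ₗ
          (TensorProduct.mk F (B ⊗[F] Q) R).flip (r i)) =
        ((TensorProduct.assoc F _ Q R).toLinearMap ∘ₗ
          (TensorProduct.mk F ((⨂[F]^n B) ⊗[F] Q) R).flip
            (List.ofFn r).prod).compMultilinearMap (collect F B Q n) := by
      refine multilinearMap_tensorProduct_ext fun b q => ?_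
      simp only [MultilinearMap.compLinearMap_apply, LinearMap.compMultilinearMap_apply,
        LinearMap.comp_apply, LinearMap.flip_apply, TensorProduct.mk_apply, LinearEquiv.coe_coe,
        TensorProduct.assoc_tmul, collect_tmul, List.prod_ofFn_tmul]
    have := congrArg (fun f => f fun i => ρ (a i)) h'
    simpa only [MultilinearMap.compLinearMap_apply, LinearMap.compMultilinearMap_apply,
      LinearMap.comp_apply, LinearMap.flip_apply, TensorProduct.mk_apply, LinearEquiv.coe_coe,
      LinearMap.rTensor_tmul, collect_tmul, inducedCoact_tprod] using this
  exact congrArg (fun f => f x) h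

theorem inducedCoact_coactComp (ρ : A →ₗ[F] A ⊗[F] Q) (σ : A →ₗ[F] A ⊗[F] R) (n : ℕ) :
    inducedCoact (coactComp ρ σ) n = coactComp (inducedCoact ρ n) (inducedCoact σ n) := by
  ext a
  simp only [LinearMap.compMultilinearMap_apply, inducedCoact_tprod, coactComp,
    LinearMap.comp_apply, LinearEquiv.coe_coe, collect_rTensor_assoc]

variable {SA : OmegaAlgebra F s t A} {SB : OmegaAlgebra F s t B}

theorem IsComeasuring.lTensor_comp {ρ : A →ₗ[F] B ⊗[F] Q} (h : IsComeasuring SA SB ρ)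
    (φ : Q →ₐ[F] R) : IsComeasuring SA SB (φ.toLinearMap.lTensor B ∘ₗ ρ) := by
  intro ω
  rw [inducedCoact_lTensor_comp, inducedCoact_lTensor_comp, LinearMap.comp_assoc, h ω,
    ← LinearMap.comp_assoc, ← LinearMap.comp_assoc, LinearMap.lTensor_comp_rTensor,
    LinearMap.rTensor_comp_lTensor]

/-- Source and target differ so that `f` can be an operation between two tensor powers. -/
theorem coactComp_comp {M N : Type*} [AddCommGroup M] [Module F M] [AddCommGroup N] [Module F N]
    {f : M →ₗ[F] N} {ρ : M →ₗ[F] M ⊗[F] Q} {ρ' : N →ₗ[F] N ⊗[F] Q} {σ : M →ₗ[F] M ⊗[F] R}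
    {σ' : N →ₗ[F] N ⊗[F] R} (hρ : ρ' ∘ₗ f = f.rTensor Q ∘ₗ ρ) (hσ : σ' ∘ₗ f = f.rTensor R ∘ₗ σ) :
    coactComp ρ' σ' ∘ₗ f = f.rTensor (Q ⊗[F] R) ∘ₗ coactComp ρ σ := by
  have h1 : f.rTensor (Q ⊗[F] R) ∘ₗ (TensorProduct.assoc F M Q R).toLinearMap =
      (TensorProduct.assoc F N Q R).toLinearMap ∘ₗ (f.rTensor Q).rTensor R :=
    TensorProduct.ext_threefold fun _ _ _ => rfl
  rw [coactComp, coactComp, LinearMap.comp_assoc, LinearMap.comp_assoc, hσ,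
    ← LinearMap.comp_assoc σ, ← LinearMap.rTensor_comp, hρ, LinearMap.rTensor_comp,
    ← LinearMap.comp_assoc _ _ (f.rTensor (Q ⊗[F] R)), h1]
  rfl

end Comeasuring

section ComeasuringEnd

variable {F : Type*} [Field F] {Ω : Type*} {s t : Ω → ℕ} {A Q R : Type*} [AddCommGroup A]
  [Module F A] [Ring Q] [Algebra F Q] [Ring R] [Algebra F R] {S : OmegaAlgebra F s t A}

theorem IsComeasuring.coactComp {ρ : A →ₗ[F] A ⊗[F] Q}
    {σ : A →ₗ[F] A ⊗[F] R} (hρ : IsComeasuring S S ρ) (hσ : IsComeasuring S S σ) :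
    IsComeasuring S S (_root_.coactComp ρ σ) := by
  intro ω
  rw [inducedCoact_coactComp, inducedCoact_coactComp]
  exact coactComp_comp (hρ ω) (hσ ω)

/-- The trivial coaction `a ↦ a ⊗ 1`. -/
noncomputable def trivialCoact (F A Q : Type*) [Field F] [AddCommGroup A] [Module F A] [Ring Q]
    [Algebra F Q] : A →ₗ[F] A ⊗[F] Q :=
  (TensorProduct.mk F A Q).flip 1

theorem inducedCoact_trivialCoact (n : ℕ) :
    inducedCoact (trivialCoact F A Q) n = trivialCoact F (⨂[F]^n A) Q := by
  ext a
  simp only [LinearMap.compMultilinearMap_apply, inducedCoact_tprod, trivialCoact,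
    LinearMap.flip_apply, TensorProduct.mk_apply, collect_tmul]
  simp

theorem isComeasuring_trivialCoact : IsComeasuring S S (trivialCoact F A Q) := by
  intro ω
  rw [inducedCoact_trivialCoact, inducedCoact_trivialCoact]
  rfl

theorem cosupport_trivialCoact_le (W : Subalgebra F (Module.End F A)) :
    cosupport (trivialCoact F A Q) ≤ Subalgebra.toSubmodule W := by
  rintro _ ⟨q, rfl⟩
  have : coactDual (trivialCoact F A Q) q = algebraMap F (Module.End F A) (q 1) := by
    ext a
    simp [coactDual_apply, trivialCoact]
  rw [this]
  exact W.algebraMap_mem _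

end ComeasuringEnd

/-! ### Bialgebra coactions. -/

section Coaction

variable {F : Type*} [Field F] {Ω : Type*} {s t : Ω → ℕ} {A : Type*} [AddCommGroup A]
  [Module F A] {S : OmegaAlgebra F s t A} {B B' : Type*} [Ring B] [Bialgebra F B] [Ring B']
  [Bialgebra F B'] {ρ : A →ₗ[F] A ⊗[F] B}

/-- The cosupport of a coaction, as a subalgebra. -/
noncomputable def IsCoaction.cosupportSubalgebra (h : IsCoaction S ρ) :
    Subalgebra F (Module.End F A) where
  __ := cosupport ρ
  mul_mem' := by
    rintro _ _ ⟨q, rfl⟩ ⟨r, rfl⟩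
    -- A product of slices becomes a slice of `(id ⊗ Δ) ρ`, hence of `ρ`.
    rw [← coactDual_coactComp, coactComp, h.coassoc]
    exact cosupport_lTensor_comp_le _ _ (coactDual_mem_cosupport _ _)
  algebraMap_mem' r := by
    -- The slice along the counit is the identity.
    refine ⟨r • Coalgebra.counit, ?_⟩
    rw [map_smul, Algebra.algebraMap_eq_smul_one]
    exact congrArg (r • ·) h.counit

theorem IsCoaction.lTensor_comp (h : IsCoaction S ρ) (φ : B →ₐc[F] B') :
    IsCoaction S ((φ : B →ₗ[F] B').lTensor A ∘ₗ ρ) where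
  coassoc := by
    have h1 : (TensorProduct.assoc F A B' B').toLinearMap ∘ₗ
        ((φ : B →ₗ[F] B').lTensor A ∘ₗ ρ).rTensor B' ∘ₗ (φ : B →ₗ[F] B').lTensor A =
        (TensorProduct.map (φ : B →ₗ[F] B') (φ : B →ₗ[F] B')).lTensor A ∘ₗ
          (TensorProduct.assoc F A B B).toLinearMap ∘ₗ ρ.rTensor B := by
      refine TensorProduct.ext' fun a b => ?_
      simp only [LinearMap.comp_apply, LinearMap.lTensor_tmul, LinearMap.rTensor_tmul,
        LinearEquiv.coe_coe]
      induction ρ a with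
      | zero => simp
      | add x y hx hy => simp only [map_add, hx, hy, TensorProduct.add_tmul]
      | tmul c d => simp
    rw [← LinearMap.comp_assoc, ← LinearMap.comp_assoc,
      LinearMap.comp_assoc _ (LinearMap.rTensor _ _), h1,
      LinearMap.comp_assoc, LinearMap.comp_assoc, h.coassoc, ← LinearMap.comp_assoc,
      ← LinearMap.comp_assoc, ← LinearMap.lTensor_comp, ← LinearMap.lTensor_comp]
    congr 2
    exact CoalgHomClass.map_comp_comul φ
  counit := by
    rw [← LinearMap.comp_assoc ρ, ← LinearMap.lTensor_comp]
    have : Coalgebra.counit ∘ₗ (φ : B →ₗ[F] B') = Coalgebra.counit :=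
      CoalgHomClass.counit_comp φ
    rw [this, h.counit]
  comeasuring := h.comeasuring.lTensor_comp (φ : B →ₐ[F] B')

end Coaction

/-! ### Matrix coefficients and the duality between `A* ⊗ A` and `End_F(A)`. -/

section Coefficients

variable {F : Type*} [Field F] {M N P : Type*} [AddCommGroup M] [Module F M]
  [AddCommGroup N] [Module F N] [AddCommGroup P] [Module F P]

/-- `lam ↦ (lam ⊗ id) x` for `x : M ⊗ N`. -/
noncomputable def leftSlice (lam : Module.Dual F M) : M ⊗[F] N →ₗ[F] N :=
  (TensorProduct.lid F N).toLinearMap ∘ₗ lam.rTensor N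

@[simp]
theorem leftSlice_tmul (lam : Module.Dual F M) (m : M) (n : N) :
    leftSlice lam (m ⊗ₜ[F] n) = lam m • n := by
  simp [leftSlice]

theorem eq_of_leftSlice_eq {x y : M ⊗[F] N}
    (h : ∀ lam : Module.Dual F M, leftSlice lam x = leftSlice lam y) : x = y := by
  apply (TensorProduct.equivFinsuppOfBasisLeft (Module.Free.chooseBasis F M)).injective
  ext i
  rw [TensorProduct.equivFinsuppOfBasisLeft_apply, TensorProduct.equivFinsuppOfBasisLeft_apply]
  exact h _

theorem leftSlice_lTensor (lam : Module.Dual F M) (φ : N →ₗ[F] P) (x : M ⊗[F] N) :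
    leftSlice lam (φ.lTensor M x) = φ (leftSlice lam x) := by
  induction x with
  | zero => simp
  | add x y hx hy => simp only [map_add, hx, hy]
  | tmul m n => simp

variable {A Q R : Type*} [AddCommGroup A] [Module F A] [AddCommGroup Q] [Module F Q]
  [AddCommGroup R] [Module F R]

/-- The matrix coefficients of `ρ : A → A ⊗ Q`: the map `lam ⊗ a ↦ (lam ⊗ id) (ρ a)`. -/
noncomputable def coactCoeff (ρ : A →ₗ[F] A ⊗[F] Q) : Module.Dual F A ⊗[F] A →ₗ[F] Q :=
  TensorProduct.lift ((LinearMap.lcomp F Q ρ) ∘ₗ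
    (LinearMap.llcomp F (A ⊗[F] Q) (F ⊗[F] Q) Q (TensorProduct.lid F Q).toLinearMap) ∘ₗ
    LinearMap.rTensorHom Q)

@[simp]
theorem coactCoeff_tmul (ρ : A →ₗ[F] A ⊗[F] Q) (lam : Module.Dual F A) (a : A) :
    coactCoeff ρ (lam ⊗ₜ a) = leftSlice lam (ρ a) := rfl

theorem coactCoeff_injective :
    Function.Injective (coactCoeff : (A →ₗ[F] A ⊗[F] Q) → _) := fun _ _ h =>
  LinearMap.ext fun a => eq_of_leftSlice_eq fun lam => LinearMap.congr_fun h (lam ⊗ₜ a)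

theorem coactCoeff_lTensor_comp (ρ : A →ₗ[F] A ⊗[F] Q) (φ : Q →ₗ[F] R) :
    coactCoeff (φ.lTensor A ∘ₗ ρ) = φ ∘ₗ coactCoeff ρ :=
  TensorProduct.ext' fun lam a => leftSlice_lTensor lam φ (ρ a)

/-- Slicing `ρ a` by `lam` and by `q` commute; this turns cosupport conditions into vanishing
conditions on coefficients. -/
theorem apply_coactCoeff (ρ : A →ₗ[F] A ⊗[F] Q) (q : Module.Dual F Q)
    (x : Module.Dual F A ⊗[F] A) :
    q (coactCoeff ρ x) = contractLeft F A ((coactDual ρ q).lTensor _ x) := by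
  induction x with
  | zero => simp
  | add x y hx hy => simp only [map_add, hx, hy]
  | tmul lam a =>
    rw [coactCoeff_tmul, LinearMap.lTensor_tmul, contractLeft_apply, coactDual_apply]
    induction ρ a with
    | zero => simp
    | add x y hx hy => simp only [map_add, hx, hy]
    | tmul b c => simp [mul_comm]

/-- The pairing of `W` with `A* ⊗ A`. -/
noncomputable def coeffPairing (W : Submodule F (A →ₗ[F] A)) :
    Module.Dual F A ⊗[F] A →ₗ[F] (W → F) :=
  LinearMap.pi fun w => contractLeft F A ∘ₗ (w : A →ₗ[F] A).lTensor (Module.Dual F A)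

theorem coeffPairing_eq_zero_iff {W : Submodule F (A →ₗ[F] A)} {x : Module.Dual F A ⊗[F] A} :
    coeffPairing W x = 0 ↔ ∀ w ∈ W, contractLeft F A (w.lTensor _ x) = 0 := by
  simp [coeffPairing, funext_iff]

theorem coactCoeff_eq_zero {W : Submodule F (A →ₗ[F] A)} {ρ : A →ₗ[F] A ⊗[F] Q}
    (h : cosupport ρ ≤ W) {x : Module.Dual F A ⊗[F] A} (hx : coeffPairing W x = 0) :
    coactCoeff ρ x = 0 := by
  rw [← Module.forall_dual_apply_eq_zero_iff F]
  intro q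
  rw [apply_coactCoeff]
  exact coeffPairing_eq_zero_iff.1 hx _ (h (coactDual_mem_cosupport ρ q))

/-- If `f` differs on a finite set `S` from every member of `W`, some functional on `S → A` kills
the restrictions of `W` but not that of `f`. Such a functional is given by an element of `A* ⊗ A`,
which contradicts the hypothesis. -/
theorem mem_of_coeffPairing_eq_zero {W : Subalgebra F (Module.End F A)} (hW : IsFinitelyClosed W)
    {f : A →ₗ[F] A} (hf : ∀ x, coeffPairing (Subalgebra.toSubmodule W) x = 0 →
      contractLeft F A (f.lTensor _ x) = 0) : f ∈ W := by
  refine hW f fun S => ?_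
  classical
  let res : (A →ₗ[F] A) →ₗ[F] (S → A) := LinearMap.pi fun a => LinearMap.applyₗ (a : A)
  by_cases hmem : res f ∈ (Subalgebra.toSubmodule W).map res
  · obtain ⟨w, hw, hwf⟩ := hmem
    exact ⟨w, hw, fun a ha => congrFun hwf ⟨a, ha⟩⟩
  · exfalso
    obtain ⟨L, hL, hLW⟩ := Submodule.exists_dual_map_eq_bot_of_notMem hmem inferInstance
    -- The components of `L`, each tensored with its point of `S`, represent `L ∘ res` under the
    -- pairing.
    have key : ∀ g : A →ₗ[F] A, contractLeft F A (g.lTensor _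
        (∑ a : S, (L ∘ₗ LinearMap.single F (fun _ : S => A) a) ⊗ₜ[F] (a : A))) = L (res g) := by
      intro g
      simp only [map_sum, LinearMap.lTensor_tmul, contractLeft_apply, LinearMap.comp_apply]
      rw [← map_sum]
      congr 1
      exact LinearMap.sum_single_apply _ _
    refine hL ?_
    rw [← key]
    refine hf _ (coeffPairing_eq_zero_iff.2 fun w hw => ?_)
    rw [key]
    have : L (res w) ∈ ((Subalgebra.toSubmodule W).map res).map L :=
      Submodule.mem_map_of_mem (Submodule.mem_map_of_mem hw)
    rwa [hLW, Submodule.mem_bot] at this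

/-- The space of matrix coefficients of the elements of `W`. -/
def CoeffSpace (W : Submodule F (A →ₗ[F] A)) : Type _ :=
  LinearMap.range (coeffPairing W)

noncomputable instance (W : Submodule F (A →ₗ[F] A)) : AddCommGroup (CoeffSpace W) :=
  inferInstanceAs (AddCommGroup (LinearMap.range (coeffPairing W)))

noncomputable instance (W : Submodule F (A →ₗ[F] A)) : Module F (CoeffSpace W) :=
  inferInstanceAs (Module F (LinearMap.range (coeffPairing W)))

/-- The matrix coefficient of an element of `A* ⊗ A`. -/
noncomputable def coeffMk (W : Submodule F (A →ₗ[F] A)) :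
    Module.Dual F A ⊗[F] A →ₗ[F] CoeffSpace W :=
  (coeffPairing W).rangeRestrict

theorem coeffMk_surjective (W : Submodule F (A →ₗ[F] A)) : Function.Surjective (coeffMk W) :=
  LinearMap.surjective_rangeRestrict _

theorem coeffMk_eq_zero_iff {W : Submodule F (A →ₗ[F] A)} {x : Module.Dual F A ⊗[F] A} :
    coeffMk W x = 0 ↔ coeffPairing W x = 0 := by
  exact Submodule.mk_eq_zero _ _

/-- An expansion of `w a` in a basis of `W a` that works for all `w ∈ W` at once has to be finite to
define a tensor; this is where pointwise finite dimensionality enters. -/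
theorem exists_coactCoeff_eq_coeffMk {W : Submodule F (A →ₗ[F] A)}
    (hW : PointwiseFiniteDimensional W) :
    ∃ ρ : A →ₗ[F] A ⊗[F] CoeffSpace W, coactCoeff ρ = coeffMk W := by
  have ex : ∀ a : A, ∃ x : A ⊗[F] CoeffSpace W, ∀ lam : Module.Dual F A,
      leftSlice lam x = coeffMk W (lam ⊗ₜ a) := by
    intro a
    have := hW a
    set M := W.map (LinearMap.applyₗ a : (A →ₗ[F] A) →ₗ[F] A)
    obtain ⟨p, hp⟩ := M.subtype.exists_leftInverse_of_injective M.ker_subtype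
    let b := Module.finBasis F M
    -- Here `p` is a projection of `A` onto `W a`, so `b.coord k ∘ₗ p` extends the `k`-th coordinate
    -- to `A`; the tensor encodes `w a = ∑ k, (b.coord k) (p (w a)) • b k`.
    refine ⟨∑ k, (b k : A) ⊗ₜ coeffMk W ((b.coord k ∘ₗ p) ⊗ₜ a), fun lam => ?_⟩
    simp only [map_sum, leftSlice_tmul, ← map_smul]
    rw [← map_sum, ← sub_eq_zero, ← map_sub, coeffMk_eq_zero_iff,
      coeffPairing_eq_zero_iff]
    intro w hw
    have hwp : p (w a) = ⟨w a, w, hw, rfl⟩ :=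
      LinearMap.congr_fun hp (⟨w a, w, hw, rfl⟩ : M)
    have := congrArg (fun m : M => lam m) (b.sum_repr (p (w a)))
    rw [hwp] at this
    simp only [Submodule.coe_sum, Submodule.coe_smul, map_sum, map_smul, smul_eq_mul] at this
    simp only [map_sub, map_sum, map_smul, LinearMap.lTensor_tmul, contractLeft_apply,
      LinearMap.comp_apply, hwp, Module.Basis.coord_apply, smul_eq_mul]
    rw [← this, sub_eq_zero]
    exact Finset.sum_congr rfl fun _ _ => mul_comm _ _
  choose r hr using ex
  -- The pointwise choices are linear in `a` since a tensor is determined by its left slices.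
  refine ⟨{ toFun := r, map_add' := fun a b => ?_, map_smul' := fun c a => ?_ }, ?_⟩
  · exact eq_of_leftSlice_eq fun lam => by simp only [map_add, hr, TensorProduct.tmul_add]
  · refine eq_of_leftSlice_eq fun lam => ?_
    simp only [map_smul, hr, TensorProduct.tmul_smul, RingHom.id_apply]
  · exact TensorProduct.ext' fun lam a => hr a lam

/-- The universal coefficient map `A → A ⊗ CoeffSpace W`. -/
noncomputable def coeffCoact {W : Submodule F (A →ₗ[F] A)} (hW : PointwiseFiniteDimensional W) :
    A →ₗ[F] A ⊗[F] CoeffSpace W :=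
  (exists_coactCoeff_eq_coeffMk hW).choose

theorem coactCoeff_coeffCoact {W : Submodule F (A →ₗ[F] A)} (hW : PointwiseFiniteDimensional W) :
    coactCoeff (coeffCoact hW) = coeffMk W :=
  (exists_coactCoeff_eq_coeffMk hW).choose_spec

theorem cosupport_coeffCoact_le {W : Subalgebra F (Module.End F A)} (hcl : IsFinitelyClosed W)
    (hW : PointwiseFiniteDimensional (Subalgebra.toSubmodule W)) :
    cosupport (coeffCoact hW) ≤ Subalgebra.toSubmodule W := by
  rintro _ ⟨q, rfl⟩
  refine mem_of_coeffPairing_eq_zero hcl fun x hx => ?_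
  rw [← apply_coactCoeff, coactCoeff_coeffCoact, coeffMk_eq_zero_iff.2 hx, map_zero]

/-- The coefficients of `ρ` vanish on the kernel of `coeffMk W`, so they factor through this
quotient; `g` below is a linear section of it. -/
theorem exists_lTensor_comp_coeffCoact {W : Submodule F (A →ₗ[F] A)}
    (hW : PointwiseFiniteDimensional W) {ρ : A →ₗ[F] A ⊗[F] Q} (h : cosupport ρ ≤ W) :
    ∃ θ : CoeffSpace W →ₗ[F] Q, θ.lTensor A ∘ₗ coeffCoact hW = ρ := by
  obtain ⟨g, hg⟩ := (coeffMk W).exists_rightInverse_of_surjective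
    (LinearMap.range_eq_top.2 (coeffMk_surjective W))
  refine ⟨coactCoeff ρ ∘ₗ g, coactCoeff_injective ?_⟩
  rw [coactCoeff_lTensor_comp, coactCoeff_coeffCoact]
  refine LinearMap.ext fun x => ?_
  rw [LinearMap.comp_apply, LinearMap.comp_apply, ← sub_eq_zero, ← map_sub]
  refine coactCoeff_eq_zero h ?_
  rw [← coeffMk_eq_zero_iff, map_sub, sub_eq_zero]
  exact LinearMap.congr_fun hg _

theorem coeffCoact_hom_ext {W : Submodule F (A →ₗ[F] A)} (hW : PointwiseFiniteDimensional W)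
    {f g : CoeffSpace W →ₗ[F] Q}
    (h : f.lTensor A ∘ₗ coeffCoact hW = g.lTensor A ∘ₗ coeffCoact hW) : f = g := by
  have := congrArg coactCoeff h
  rw [coactCoeff_lTensor_comp, coactCoeff_lTensor_comp, coactCoeff_coeffCoact] at this
  exact (LinearMap.cancel_right (coeffMk_surjective W)).1 this

end Coefficients

/-! ### The universal comeasuring algebra. -/

section UniversalComeasuring

variable {F : Type*} [Field F] {Ω : Type*} {s t : Ω → ℕ} {A : Type*} [AddCommGroup A]
  [Module F A] (S : OmegaAlgebra F s t A) {W : Subalgebra F (Module.End F A)}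
  (hW : PointwiseFiniteDimensional (Subalgebra.toSubmodule W))

/-- The coefficient map with values in the tensor algebra of the coefficient space. -/
noncomputable def freeCoeffCoact :
    A →ₗ[F] A ⊗[F] TensorAlgebra F (CoeffSpace (Subalgebra.toSubmodule W)) :=
  (TensorAlgebra.ι F).lTensor A ∘ₗ coeffCoact hW

/-- The relations that make `freeCoeffCoact` preserve the operations. -/
inductive ComeasuringRel : TensorAlgebra F (CoeffSpace (Subalgebra.toSubmodule W)) →
    TensorAlgebra F (CoeffSpace (Subalgebra.toSubmodule W)) → Prop
  | op (ω : Ω) (m : ⨂[F]^(s ω) A) (lam : Module.Dual F (⨂[F]^(t ω) A)) : ComeasuringRel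
      (leftSlice lam (inducedCoact (freeCoeffCoact hW) (t ω) (S.op ω m)))
      (leftSlice lam ((S.op ω).rTensor _ (inducedCoact (freeCoeffCoact hW) (s ω) m)))

/-- The universal algebra with a comeasuring `A → A ⊗ U` whose cosupport lies in `W`. -/
def UniversalComeasuringAlgebra : Type _ := RingQuot (ComeasuringRel S hW)

noncomputable instance : Ring (UniversalComeasuringAlgebra S hW) :=
  inferInstanceAs (Ring (RingQuot (ComeasuringRel S hW)))

noncomputable instance : Algebra F (UniversalComeasuringAlgebra S hW) :=
  inferInstanceAs (Algebra F (RingQuot (ComeasuringRel S hW)))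

namespace UniversalComeasuringAlgebra

/-- The quotient map from the tensor algebra. -/
noncomputable def mk : TensorAlgebra F (CoeffSpace (Subalgebra.toSubmodule W)) →ₐ[F]
    UniversalComeasuringAlgebra S hW :=
  RingQuot.mkAlgHom F (ComeasuringRel S hW)

theorem mk_eq {x y : TensorAlgebra F (CoeffSpace (Subalgebra.toSubmodule W))}
    (h : ComeasuringRel S hW x y) : mk S hW x = mk S hW y :=
  RingQuot.mkAlgHom_rel F h

variable {S hW} in
theorem hom_ext_mk {R : Type*} [Ring R] [Algebra F R]
    {f g : UniversalComeasuringAlgebra S hW →ₐ[F] R}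
    (h : f.comp (mk S hW) = g.comp (mk S hW)) : f = g :=
  RingQuot.ringQuot_ext' F f g h

theorem exists_comp_mk_eq {R : Type*} [Ring R] [Algebra F R]
    (θ : TensorAlgebra F (CoeffSpace (Subalgebra.toSubmodule W)) →ₐ[F] R)
    (h : ∀ ⦃x y⦄, ComeasuringRel S hW x y → θ x = θ y) :
    ∃ φ : UniversalComeasuringAlgebra S hW →ₐ[F] R, φ.comp (mk S hW) = θ :=
  ⟨RingQuot.liftAlgHom F ⟨θ, h⟩, AlgHom.ext (RingQuot.liftAlgHom_mkAlgHom_apply F θ h)⟩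

/-- The universal comeasuring. -/
noncomputable def coact : A →ₗ[F] A ⊗[F] UniversalComeasuringAlgebra S hW :=
  (mk S hW).toLinearMap.lTensor A ∘ₗ freeCoeffCoact hW

/-- The identity of tensors is tested on left slices, and each sliced identity is one of the imposed
relations. -/
theorem isComeasuring_coact : IsComeasuring S S (coact S hW) := by
  intro ω
  rw [coact, inducedCoact_lTensor_comp, inducedCoact_lTensor_comp]
  refine LinearMap.ext fun m => eq_of_leftSlice_eq fun lam => ?_
  rw [LinearMap.comp_assoc, LinearMap.comp_apply, leftSlice_lTensor, ← LinearMap.comp_assoc,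
    LinearMap.rTensor_comp_lTensor, ← LinearMap.lTensor_comp_rTensor, LinearMap.comp_assoc,
    LinearMap.comp_apply (LinearMap.lTensor _ _), leftSlice_lTensor]
  exact mk_eq S hW (ComeasuringRel.op ω m lam)

theorem cosupport_coact_le (hcl : IsFinitelyClosed W) :
    cosupport (coact S hW) ≤ Subalgebra.toSubmodule W :=
  ((cosupport_lTensor_comp_le _ _).trans (cosupport_lTensor_comp_le _ _)).trans
    (cosupport_coeffCoact_le hcl hW)

variable {S hW} {R : Type*} [Ring R] [Algebra F R]

theorem hom_ext {f g : UniversalComeasuringAlgebra S hW →ₐ[F] R}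
    (h : f.toLinearMap.lTensor A ∘ₗ coact S hW = g.toLinearMap.lTensor A ∘ₗ coact S hW) :
    f = g := by
  refine hom_ext_mk (TensorAlgebra.hom_ext (coeffCoact_hom_ext hW ?_))
  rw [coact, freeCoeffCoact, ← LinearMap.comp_assoc, ← LinearMap.comp_assoc,
    ← LinearMap.comp_assoc, ← LinearMap.comp_assoc, ← LinearMap.lTensor_comp,
    ← LinearMap.lTensor_comp, ← LinearMap.lTensor_comp, ← LinearMap.lTensor_comp] at h
  exact h

theorem exists_hom {ρ : A →ₗ[F] A ⊗[F] R} (hρ : IsComeasuring S S ρ)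
    (hsupp : cosupport ρ ≤ Subalgebra.toSubmodule W) :
    ∃ φ : UniversalComeasuringAlgebra S hW →ₐ[F] R,
      φ.toLinearMap.lTensor A ∘ₗ coact S hW = ρ := by
  obtain ⟨θ₀, hθ₀⟩ := exists_lTensor_comp_coeffCoact hW hsupp
  set θ := TensorAlgebra.lift F θ₀
  have hθ : θ.toLinearMap.lTensor A ∘ₗ freeCoeffCoact hW = ρ := by
    rw [freeCoeffCoact, ← LinearMap.comp_assoc, ← LinearMap.lTensor_comp,
      TensorAlgebra.ι_comp_lift, hθ₀]
  have hrel : ∀ ⦃x y⦄, ComeasuringRel S hW x y → θ x = θ y := by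
    rintro _ _ ⟨ω, m, lam⟩
    rw [← AlgHom.toLinearMap_apply, ← AlgHom.toLinearMap_apply, ← leftSlice_lTensor,
      ← leftSlice_lTensor]
    have := hρ ω
    rw [← hθ, inducedCoact_lTensor_comp, inducedCoact_lTensor_comp, ← LinearMap.comp_assoc,
      LinearMap.rTensor_comp_lTensor, ← LinearMap.lTensor_comp_rTensor] at this
    exact congrArg (leftSlice lam) (LinearMap.congr_fun this m)
  obtain ⟨φ, hφ⟩ := exists_comp_mk_eq S hW θ hrel
  refine ⟨φ, ?_⟩
  rw [coact, ← LinearMap.comp_assoc, ← LinearMap.lTensor_comp, ← AlgHom.comp_toLinearMap, hφ, hθ]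

/-- The algebra homomorphism through which a comeasuring with cosupport in `W` factors. -/
noncomputable def lift {ρ : A →ₗ[F] A ⊗[F] R} (hρ : IsComeasuring S S ρ)
    (hsupp : cosupport ρ ≤ Subalgebra.toSubmodule W) : UniversalComeasuringAlgebra S hW →ₐ[F] R :=
  (exists_hom hρ hsupp).choose

theorem lTensor_lift_comp {ρ : A →ₗ[F] A ⊗[F] R} (hρ : IsComeasuring S S ρ)
    (hsupp : cosupport ρ ≤ Subalgebra.toSubmodule W) :
    (lift hρ hsupp : UniversalComeasuringAlgebra S hW →ₐ[F] R).toLinearMap.lTensor A ∘ₗ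
      coact S hW = ρ :=
  (exists_hom hρ hsupp).choose_spec

end UniversalComeasuringAlgebra

end UniversalComeasuring

/-! ### Associativity and unit laws for composing coactions. -/

section CoactComp

variable {F : Type*} [Field F] {A Q R T Q' R' : Type*} [AddCommGroup A] [Module F A]
  [AddCommGroup Q] [Module F Q] [AddCommGroup R] [Module F R] [AddCommGroup T] [Module F T]
  [AddCommGroup Q'] [Module F Q'] [AddCommGroup R'] [Module F R']

theorem lTensor_assoc_comp_coactComp (ρ : A →ₗ[F] A ⊗[F] Q) (σ : A →ₗ[F] A ⊗[F] R)
    (τ : A →ₗ[F] A ⊗[F] T) :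
    (TensorProduct.assoc F Q R T).toLinearMap.lTensor A ∘ₗ coactComp (coactComp ρ σ) τ =
      coactComp ρ (coactComp σ τ) := by
  ext a
  simp only [coactComp, LinearMap.comp_apply, LinearEquiv.coe_coe]
  induction τ a with
  | zero => simp
  | add x y hx hy => simp only [map_add, hx, hy]
  | tmul b c =>
    simp only [LinearMap.rTensor_tmul, LinearMap.comp_apply, LinearEquiv.coe_coe]
    induction σ b with
    | zero => simp
    | add x y hx hy => simp only [map_add, TensorProduct.add_tmul, hx, hy]
    | tmul d e =>
      simp only [LinearMap.rTensor_tmul, TensorProduct.assoc_tmul]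
      induction ρ d with
      | zero => simp
      | add x y hx hy => simp only [map_add, TensorProduct.add_tmul, hx, hy]
      | tmul x y => simp

theorem lTensor_map_comp_coactComp (ρ : A →ₗ[F] A ⊗[F] Q) (σ : A →ₗ[F] A ⊗[F] R)
    (f : Q →ₗ[F] Q') (g : R →ₗ[F] R') :
    (TensorProduct.map f g).lTensor A ∘ₗ coactComp ρ σ =
      coactComp (f.lTensor A ∘ₗ ρ) (g.lTensor A ∘ₗ σ) := by
  ext a
  simp only [coactComp, LinearMap.comp_apply, LinearEquiv.coe_coe]
  induction σ a with
  | zero => simp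
  | add x y hx hy => simp only [map_add, hx, hy]
  | tmul b c =>
    simp only [LinearMap.rTensor_tmul, LinearMap.lTensor_tmul, LinearMap.comp_apply]
    induction ρ b with
    | zero => simp
    | add x y hx hy => simp only [map_add, TensorProduct.add_tmul, hx, hy]
    | tmul x y => simp

theorem coactComp_trivialCoact_left (σ : A →ₗ[F] A ⊗[F] R) :
    coactComp (trivialCoact F A F) σ =
      (TensorProduct.lid F R).symm.toLinearMap.lTensor A ∘ₗ σ := by
  ext a
  simp only [coactComp, LinearMap.comp_apply, LinearEquiv.coe_coe]
  induction σ a with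
  | zero => simp
  | add x y hx hy => simp only [map_add, hx, hy]
  | tmul b c => simp [trivialCoact]

theorem coactComp_trivialCoact_right (ρ : A →ₗ[F] A ⊗[F] Q) :
    coactComp ρ (trivialCoact F A F) =
      (TensorProduct.rid F Q).symm.toLinearMap.lTensor A ∘ₗ ρ := by
  ext a
  simp only [coactComp, LinearMap.comp_apply, LinearEquiv.coe_coe, trivialCoact,
    LinearMap.flip_apply, TensorProduct.mk_apply, LinearMap.rTensor_tmul]
  induction ρ a with
  | zero => simp
  | add x y hx hy => simp only [map_add, TensorProduct.add_tmul, hx, hy]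
  | tmul b c => simp

theorem rid_comp_trivialCoact :
    (TensorProduct.rid F A).toLinearMap ∘ₗ trivialCoact F A F = LinearMap.id := by
  ext a
  simp [trivialCoact]

end CoactComp

/-! ### The bialgebra structure of the universal comeasuring algebra. -/

namespace UniversalComeasuringAlgebra

variable {F : Type*} [Field F] {Ω : Type*} {s t : Ω → ℕ} {A : Type*} [AddCommGroup A]
  [Module F A] (S : OmegaAlgebra F s t A) {W : Subalgebra F (Module.End F A)}
  (hW : PointwiseFiniteDimensional (Subalgebra.toSubmodule W)) (hcl : IsFinitelyClosed W)

/-- The comultiplication, induced by the square of the universal comeasuring. -/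
noncomputable def comulAlgHom : UniversalComeasuringAlgebra S hW →ₐ[F]
    UniversalComeasuringAlgebra S hW ⊗[F] UniversalComeasuringAlgebra S hW :=
  lift ((isComeasuring_coact S hW).coactComp (isComeasuring_coact S hW))
    (cosupport_coactComp_le hcl (cosupport_coact_le S hW hcl) (cosupport_coact_le S hW hcl))

/-- The counit, induced by the trivial comeasuring. -/
noncomputable def counitAlgHom : UniversalComeasuringAlgebra S hW →ₐ[F] F :=
  lift isComeasuring_trivialCoact (cosupport_trivialCoact_le W)

theorem lTensor_comulAlgHom_comp :
    (comulAlgHom S hW hcl).toLinearMap.lTensor A ∘ₗ coact S hW =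
      coactComp (coact S hW) (coact S hW) :=
  lTensor_lift_comp _ _

theorem lTensor_counitAlgHom_comp :
    (counitAlgHom S hW).toLinearMap.lTensor A ∘ₗ coact S hW = trivialCoact F A F :=
  lTensor_lift_comp _ _

theorem lTensor_comp_comp {Q R : Type*} [Ring Q] [Algebra F Q] [Ring R] [Algebra F R]
    (f : UniversalComeasuringAlgebra S hW →ₐ[F] Q) (g : Q →ₐ[F] R) :
    (g.comp f).toLinearMap.lTensor A ∘ₗ coact S hW =
      g.toLinearMap.lTensor A ∘ₗ (f.toLinearMap.lTensor A ∘ₗ coact S hW) := by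
  rw [AlgHom.comp_toLinearMap, LinearMap.lTensor_comp, LinearMap.comp_assoc]

/-- The bialgebra structure on the universal comeasuring algebra of a finitely closed subalgebra. -/
@[reducible] noncomputable def bialgebra : Bialgebra F (UniversalComeasuringAlgebra S hW) :=
  Bialgebra.ofAlgHom (comulAlgHom S hW hcl) (counitAlgHom S hW)
    (by
      -- Both sides carry the universal comeasuring to its threefold composite.
      apply hom_ext
      rw [lTensor_comp_comp, lTensor_comp_comp, lTensor_comp_comp, lTensor_comulAlgHom_comp]
      refine Eq.trans (congrArg _ (lTensor_map_comp_coactComp _ _ _ _)) ?_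
      refine Eq.trans ?_ (lTensor_map_comp_coactComp _ _ _ _).symm
      rw [lTensor_comulAlgHom_comp]
      have : (AlgHom.id F (UniversalComeasuringAlgebra S hW)).toLinearMap.lTensor A ∘ₗ
          coact S hW = coact S hW := by
        rw [AlgHom.toLinearMap_id, LinearMap.lTensor_id, LinearMap.id_comp]
      rw [this]
      exact lTensor_assoc_comp_coactComp _ _ _)
    (by
      apply hom_ext
      rw [lTensor_comp_comp, lTensor_comulAlgHom_comp]
      refine Eq.trans (lTensor_map_comp_coactComp _ _ _ _) ?_
      rw [lTensor_counitAlgHom_comp, AlgHom.toLinearMap_id, LinearMap.lTensor_id,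
        LinearMap.id_comp]
      exact coactComp_trivialCoact_left _)
    (by
      apply hom_ext
      rw [lTensor_comp_comp, lTensor_comulAlgHom_comp]
      refine Eq.trans (lTensor_map_comp_coactComp _ _ _ _) ?_
      rw [lTensor_counitAlgHom_comp, AlgHom.toLinearMap_id, LinearMap.lTensor_id,
        LinearMap.id_comp]
      exact coactComp_trivialCoact_right _)

theorem isCoaction_coact :
    letI := bialgebra S hW hcl
    IsCoaction S (coact S hW) := by
  let := bialgebra S hW hcl
  exact {
    coassoc := (lTensor_comulAlgHom_comp S hW hcl).symm
    counit := (congrArg _ (lTensor_counitAlgHom_comp S hW)).trans rid_comp_trivialCoact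
    comeasuring := isComeasuring_coact S hW }

/-- Compatibility with counit and comultiplication is an equality of algebra homomorphisms out of
the universal algebra. Tested on the universal comeasuring, it becomes counitality and
coassociativity of `ρ`. -/
theorem exists_bialgHom {B : Type*} [Ring B] [Bialgebra F B] {ρ : A →ₗ[F] A ⊗[F] B}
    (hρ : IsCoaction S ρ) (hsupp : cosupport ρ ≤ Subalgebra.toSubmodule W) :
    letI := bialgebra S hW hcl
    ∃ φ : UniversalComeasuringAlgebra S hW →ₐc[F] B,
      (φ : UniversalComeasuringAlgebra S hW →ₗ[F] B).lTensor A ∘ₗ coact S hW = ρ := by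
  let := bialgebra S hW hcl
  obtain ⟨φ, hφ⟩ := exists_hom (hW := hW) hρ.comeasuring hsupp
  refine ⟨BialgHom.ofAlgHom φ ?_ ?_, hφ⟩
  · refine hom_ext (Eq.trans ?_ (lTensor_counitAlgHom_comp S hW).symm)
    rw [lTensor_comp_comp, hφ]
    have h := hρ.counit
    refine LinearMap.ext fun a => (TensorProduct.rid F A).injective ?_
    exact (LinearMap.congr_fun h a).trans (LinearMap.congr_fun rid_comp_trivialCoact a).symm
  · refine hom_ext ?_
    rw [lTensor_comp_comp, lTensor_comp_comp, hφ]
    have h1 := lTensor_comulAlgHom_comp S hW hcl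
    refine Eq.trans (congrArg _ h1) (Eq.trans (lTensor_map_comp_coactComp _ _ _ _) ?_)
    rw [hφ]
    exact hρ.coassoc

end UniversalComeasuringAlgebra

/-! ### The criterion for bialgebras. -/

section Universal

variable {F : Type u} [Field F] {Ω : Type w} {s t : Ω → ℕ} {A : Type v} [AddCommGroup A]
  [Module F A] {S : OmegaAlgebra F s t A} {V W : Subalgebra F (Module.End F A)}

theorem exists_isUniversalBialgebraCoaction (hcl : IsFinitelyClosed W)
    (hW : PointwiseFiniteDimensional (Subalgebra.toSubmodule W)) :
    UniversalCoactingBialgebraExists S W := by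
  let := UniversalComeasuringAlgebra.bialgebra S hW hcl
  refine ⟨UniversalComeasuringAlgebra S hW, inferInstance, this,
    UniversalComeasuringAlgebra.coact S hW,
    UniversalComeasuringAlgebra.isCoaction_coact S hW hcl,
    UniversalComeasuringAlgebra.cosupport_coact_le S hW hcl, fun B' _ _ ρ' hρ' hsupp => ?_⟩
  obtain ⟨φ, hφ⟩ := UniversalComeasuringAlgebra.exists_bialgHom S hW hcl hρ' hsupp
  exact ⟨φ, hφ, fun ψ hψ => UniversalComeasuringAlgebra.hom_ext (hψ.trans hφ.symm)⟩

theorem bialgebraCosupportAlgebra_le : bialgebraCosupportAlgebra S V ≤ V :=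
  Algebra.adjoin_le fun _ ⟨_, _, _, _, _, h, hf⟩ => h hf

theorem hopfCosupportAlgebra_le : hopfCosupportAlgebra S V ≤ V :=
  Algebra.adjoin_le fun _ ⟨_, _, _, _, _, h, hf⟩ => h hf

theorem UniversalCoactingBialgebraExists.pointwiseFiniteDimensional
    (h : UniversalCoactingBialgebraExists S V) :
    PointwiseFiniteDimensional (Subalgebra.toSubmodule (bialgebraCosupportAlgebra S V)) := by
  obtain ⟨B, _, _, ρ, hρ⟩ := h
  refine (pointwiseFiniteDimensional_cosupport ρ).mono ?_
  have : bialgebraCosupportAlgebra S V ≤ hρ.isCoaction.cosupportSubalgebra := by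
    refine Algebra.adjoin_le ?_
    rintro f ⟨B', _, _, ρ', hρ', hV, hf⟩
    obtain ⟨φ, rfl, -⟩ := hρ.universal B' ρ' hρ' hV
    exact cosupport_lTensor_comp_le _ _ hf
  exact this

theorem UniversalCoactingHopfAlgebraExists.pointwiseFiniteDimensional
    (h : UniversalCoactingHopfAlgebraExists S V) :
    PointwiseFiniteDimensional (Subalgebra.toSubmodule (hopfCosupportAlgebra S V)) := by
  obtain ⟨B, _, _, ρ, hρ⟩ := h
  refine (pointwiseFiniteDimensional_cosupport ρ).mono ?_
  have : hopfCosupportAlgebra S V ≤ hρ.isCoaction.cosupportSubalgebra := by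
    refine Algebra.adjoin_le ?_
    rintro f ⟨B', _, _, ρ', hρ', hV, hf⟩
    obtain ⟨φ, rfl, -⟩ := hρ.universal B' ρ' hρ' hV
    exact cosupport_lTensor_comp_le _ _ hf
  exact this

/-- With `W` the finite closure of the generated algebra, a coaction has cosupport in `V` exactly
when it has cosupport in `W`, so a `W`-universal coaction is `V`-universal. -/
theorem universalCoactingBialgebraExists_iff (hV : IsFinitelyClosed V) :
    UniversalCoactingBialgebraExists S V ↔
      PointwiseFiniteDimensional (Subalgebra.toSubmodule (bialgebraCosupportAlgebra S V)) := by
  refine ⟨fun h => h.pointwiseFiniteDimensional, fun h => ?_⟩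
  obtain ⟨B, _, _, ρ, hρ⟩ := exists_isUniversalBialgebraCoaction (S := S)
    isFinitelyClosed_finiteClosure (pointwiseFiniteDimensional_finiteClosure h)
  refine ⟨B, _, _, ρ, hρ.isCoaction,
    hρ.cosupport_le.trans (finiteClosure_le hV bialgebraCosupportAlgebra_le),
    fun B' _ _ ρ' hρ' hsupp => hρ.universal B' ρ' hρ' fun f hf => le_finiteClosure ?_⟩
  exact Algebra.subset_adjoin ⟨B', _, _, ρ', hρ', hsupp, hf⟩

end Universal

/-! ### Convolution inverses, also with values in the opposite algebra. -/

section ConvolutionInverse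

open WithConv

variable {F : Type*} [Field F] {C D R R' : Type*} [AddCommGroup C] [Module F C] [Coalgebra F C]
  [AddCommGroup D] [Module F D] [Coalgebra F D] [Ring R] [Algebra F R] [Ring R'] [Algebra F R']

/-- `f` and `g` are mutually inverse with respect to convolution. -/
def IsConvInverse (f g : C →ₗ[F] R) : Prop :=
  toConv f * toConv g = 1 ∧ toConv g * toConv f = 1

theorem toConv_mul_toConv_eq_one_iff {f g : C →ₗ[F] R} : toConv f * toConv g = 1 ↔
    ∀ x, LinearMap.mul' F R (TensorProduct.map f g (Coalgebra.comul x)) =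
      algebraMap F R (Coalgebra.counit x) := by
  constructor
  · intro h x
    exact congrArg (fun k => k x) h
  · intro h
    ext x
    exact h x

theorem IsConvInverse.right_unique {f g g' : C →ₗ[F] R} (h : IsConvInverse f g)
    (h' : IsConvInverse f g') : g = g' :=
  toConv_injective (left_inv_eq_right_inv h.2 h'.1)

theorem IsConvInverse.mul {f g f' g' : C →ₗ[F] R} (h : IsConvInverse f g)
    (h' : IsConvInverse f' g') :
    IsConvInverse (toConv f * toConv f').ofConv (toConv g' * toConv g).ofConv := by
  constructor
  · calc toConv f * toConv f' * (toConv g' * toConv g)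
        = toConv f * (toConv f' * toConv g') * toConv g := by simp only [mul_assoc]
      _ = 1 := by rw [h'.1, mul_one, h.1]
  · calc toConv g' * toConv g * (toConv f * toConv f')
        = toConv g' * (toConv g * toConv f) * toConv f' := by simp only [mul_assoc]
      _ = 1 := by rw [h.2, mul_one, h'.2]

theorem IsConvInverse.congr {f g f' g' : C →ₗ[F] R} (h : IsConvInverse f g)
    (hf : ∀ x, f x = f' x) (hg : ∀ x, g x = g' x) : IsConvInverse f' g' := by
  rwa [← LinearMap.ext hf, ← LinearMap.ext hg]

theorem mul'_map_comp {C : Type*} [AddCommGroup C] [Module F C]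
    (φ : R →ₐ[F] R') (f g : C →ₗ[F] R) (z : C ⊗[F] C) :
    LinearMap.mul' F R' (TensorProduct.map (φ.toLinearMap ∘ₗ f) (φ.toLinearMap ∘ₗ g) z) =
      φ (LinearMap.mul' F R (TensorProduct.map f g z)) := by
  induction z with
  | zero => simp
  | add x y hx hy => simp only [map_add, hx, hy]
  | tmul x y => simp

theorem IsConvInverse.algHom_comp {f g : C →ₗ[F] R} (h : IsConvInverse f g) (φ : R →ₐ[F] R') :
    IsConvInverse (φ.toLinearMap ∘ₗ f) (φ.toLinearMap ∘ₗ g) := by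
  simp only [IsConvInverse, toConv_mul_toConv_eq_one_iff, mul'_map_comp] at h ⊢
  exact ⟨fun x => by rw [h.1, AlgHom.commutes], fun x => by rw [h.2, AlgHom.commutes]⟩

theorem IsConvInverse.comp_coalgHom {f g : C →ₗ[F] R} (h : IsConvInverse f g) (φ : D →ₗc[F] C) :
    IsConvInverse (f ∘ₗ φ.toLinearMap) (g ∘ₗ φ.toLinearMap) := by
  simp only [IsConvInverse, toConv_mul_toConv_eq_one_iff, TensorProduct.map_comp,
    LinearMap.comp_apply] at h ⊢
  have h1 : ∀ x, TensorProduct.map φ.toLinearMap φ.toLinearMap (Coalgebra.comul x) =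
    Coalgebra.comul (R := F) (φ x) := fun x => LinearMap.congr_fun φ.map_comp_comul x
  have h2 : ∀ x, Coalgebra.counit (R := F) (φ x) = Coalgebra.counit (R := F) x :=
    fun x => LinearMap.congr_fun φ.counit_comp x
  exact ⟨fun x => by rw [h1, ← h2]; exact h.1 _, fun x => by rw [h1, ← h2]; exact h.2 _⟩

/-- The linear map `R → Rᵐᵒᵖ`. -/
noncomputable abbrev opLin (F R : Type*) [Field F] [Ring R] [Algebra F R] : R →ₗ[F] Rᵐᵒᵖ :=
  (MulOpposite.opLinearEquiv F : R ≃ₗ[F] Rᵐᵒᵖ).toLinearMap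

/-- The linear map `Rᵐᵒᵖ → R`. -/
noncomputable abbrev unopLin (F R : Type*) [Field F] [Ring R] [Algebra F R] : Rᵐᵒᵖ →ₗ[F] R :=
  (MulOpposite.opLinearEquiv F : R ≃ₗ[F] Rᵐᵒᵖ).symm.toLinearMap

theorem mul'_map_op {C : Type*} [AddCommGroup C] [Module F C] (f g : C →ₗ[F] Rᵐᵒᵖ) (z : C ⊗[F] C) :
    LinearMap.mul' F Rᵐᵒᵖ (TensorProduct.map f g z) =
      MulOpposite.op (LinearMap.mul' F R (TensorProduct.map (unopLin F R ∘ₗ g) (unopLin F R ∘ₗ f)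
        (TensorProduct.comm F C C z))) := by
  induction z with
  | zero => simp
  | add x y hx hy => simp only [map_add, hx, hy, MulOpposite.op_add]
  | tmul x y => simp

/-- Multiplying in `Rᵐᵒᵖ` amounts to flipping the comultiplication and multiplying in `R`; in this
form the condition can be imposed as a relation of the Hopf envelope. -/
theorem toConv_mul_toConv_op_eq_one_iff {f g : C →ₗ[F] Rᵐᵒᵖ} : toConv f * toConv g = 1 ↔
    ∀ x, LinearMap.mul' F R (TensorProduct.map (unopLin F R ∘ₗ g) (unopLin F R ∘ₗ f)
      (TensorProduct.comm F C C (Coalgebra.comul x))) = algebraMap F R (Coalgebra.counit x) := by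
  rw [toConv_mul_toConv_eq_one_iff]
  refine forall_congr' fun x => ?_
  rw [mul'_map_op, MulOpposite.algebraMap_apply, MulOpposite.op_inj]

end ConvolutionInverse

/-! ### Chains of successive convolution inverses. -/

section AntipodeChain

variable {F : Type*} [Field F] {B R R' : Type*} [Ring B] [Bialgebra F B] [Ring R] [Algebra F R]
  [Ring R'] [Algebra F R']

/-- A sequence of homomorphisms `g₀, h₀, g₁, h₁, …` from `B` alternatingly to `R` and `Rᵐᵒᵖ`, each
of which is the convolution inverse of the preceding one. -/
structure AntipodeChain (F B R : Type*) [Field F] [Ring B] [Bialgebra F B] [Ring R]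
    [Algebra F R] where
  g : ℕ → B →ₐ[F] R
  h : ℕ → B →ₐ[F] Rᵐᵒᵖ
  inv : ∀ n, IsConvInverse (g n).toLinearMap (unopLin F R ∘ₗ (h n).toLinearMap)
  inv_op : ∀ n, IsConvInverse (h n).toLinearMap (opLin F R ∘ₗ (g (n + 1)).toLinearMap)

namespace AntipodeChain

/-- The image of a chain under an algebra homomorphism. -/
noncomputable def map (c : AntipodeChain F B R) (φ : R →ₐ[F] R') : AntipodeChain F B R' where
  g n := φ.comp (c.g n)
  h n := (AlgHom.op φ).comp (c.h n)
  inv n := (c.inv n).algHom_comp φ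
  inv_op n := (c.inv_op n).algHom_comp (AlgHom.op φ)

/-- Convolution inverses are unique, so each term of a chain determines the next. -/
theorem ext_zero {c d : AntipodeChain F B R} (h0 : c.g 0 = d.g 0) : c = d := by
  have key : ∀ n, c.g n = d.g n → c.h n = d.h n := by
    intro n hn
    have h1 := c.inv n
    rw [hn] at h1
    have h2 := h1.right_unique (d.inv n)
    ext x
    exact MulOpposite.unop_injective (LinearMap.congr_fun h2 x)
  have hg : ∀ n, c.g n = d.g n := by
    intro n
    induction n with
    | zero => exact h0
    | succ n ih =>
      have h1 := c.inv_op n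
      rw [key n ih] at h1
      have h2 := h1.right_unique (d.inv_op n)
      ext x
      exact MulOpposite.op_injective (LinearMap.congr_fun h2 x)
  have hg' : c.g = d.g := funext hg
  have hh' : c.h = d.h := funext fun n => key n (hg n)
  cases c; cases d; subst hg' hh'; rfl

open WithConv in
/-- The tensor product of two chains. -/
noncomputable def tmul (c : AntipodeChain F B R) (d : AntipodeChain F B R') :
    AntipodeChain F B (R ⊗[F] R') where
  g n := (Algebra.TensorProduct.map (c.g n) (d.g n)).comp (Bialgebra.comulAlgHom F B)
  h n := (Algebra.TensorProduct.opAlgEquiv F F R R').toAlgHom.comp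
    ((Algebra.TensorProduct.map (c.h n) (d.h n)).comp
      ((Algebra.TensorProduct.comm F B B).toAlgHom.comp (Bialgebra.comulAlgHom F B)))
  inv n := by
    -- The `n`-th map `g` is the convolution product of the two `g n` placed in the tensor factors;
    -- its inverse is the product of the inverses in reverse order, whence the flip in `h`.
    have h1 := ((c.inv n).algHom_comp
      (Algebra.TensorProduct.includeLeft : R →ₐ[F] R ⊗[F] R')).mul
      ((d.inv n).algHom_comp (Algebra.TensorProduct.includeRight : R' →ₐ[F] R ⊗[F] R'))
    refine h1.congr (fun x => ?_) (fun x => ?_)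
    · simp only [LinearMap.convMul_apply, AlgHom.toLinearMap_apply, AlgHom.comp_apply,
        Bialgebra.comulAlgHom_apply]
      induction Coalgebra.comul (R := F) x with
      | zero => simp
      | add x y hx hy => simp only [map_add, hx, hy]
      | tmul x y => simp
    · simp only [LinearMap.convMul_apply, AlgHom.toLinearMap_apply, AlgHom.comp_apply,
        LinearMap.comp_apply, Bialgebra.comulAlgHom_apply]
      induction Coalgebra.comul (R := F) x with
      | zero => simp
      | add x y hx hy => simp only [map_add, hx, hy]
      | tmul x y => simp
  inv_op n := by
    -- Because of the flip in `h`, the factor from `d` now comes first.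
    have h1 := ((d.inv_op n).algHom_comp (AlgHom.op
      (Algebra.TensorProduct.includeRight : R' →ₐ[F] R ⊗[F] R'))).mul
      ((c.inv_op n).algHom_comp
      (AlgHom.op (Algebra.TensorProduct.includeLeft : R →ₐ[F] R ⊗[F] R')))
    refine h1.congr (fun x => ?_) (fun x => ?_)
    · simp only [LinearMap.convMul_apply, AlgHom.toLinearMap_apply, AlgHom.comp_apply,
        Bialgebra.comulAlgHom_apply]
      induction Coalgebra.comul (R := F) x with
      | zero => simp
      | add x y hx hy => simp only [map_add, hx, hy]
      | tmul x y => simp [← MulOpposite.op_mul]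
    · simp only [LinearMap.convMul_apply, AlgHom.toLinearMap_apply, AlgHom.comp_apply,
        LinearMap.comp_apply, Bialgebra.comulAlgHom_apply]
      induction Coalgebra.comul (R := F) x with
      | zero => simp
      | add x y hx hy => simp only [map_add, hx, hy]
      | tmul x y => simp [← MulOpposite.op_mul]

/-- The chain all of whose members are the counit. -/
noncomputable def counit (F B : Type*) [Field F] [Ring B] [Bialgebra F B] :
    AntipodeChain F B F where
  g _ := Bialgebra.counitAlgHom F B
  h _ := (AlgEquiv.toOpposite F F).toAlgHom.comp (Bialgebra.counitAlgHom F B)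
  -- The counit is the unit of the convolution algebra.
  inv _ := ⟨one_mul 1, one_mul 1⟩
  inv_op _ := ⟨one_mul 1, one_mul 1⟩

/-- The chain that starts with `h₀`. -/
noncomputable def shift (c : AntipodeChain F B R) : AntipodeChain F B Rᵐᵒᵖ where
  g n := c.h n
  h n := (AlgEquiv.opOp F R).toAlgHom.comp (c.g (n + 1))
  inv n := c.inv_op n
  inv_op n := (c.inv (n + 1)).algHom_comp (AlgEquiv.opOp F R).toAlgHom

end AntipodeChain

end AntipodeChain

/-! ### The Hopf envelope of a bialgebra. -/

section HopfEnvelope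

variable (F : Type*) [Field F] (B : Type*) [Ring B] [Bialgebra F B]

/-- The generators of the Hopf envelope: `(n, false)` stands for `gₙ` and `(n, true)` for `hₙ`. -/
noncomputable def envelopeGen (k : ℕ × Bool) : B →ₗ[F] TensorAlgebra F (ℕ × Bool →₀ B) :=
  TensorAlgebra.ι F ∘ₗ Finsupp.lsingle k

/-- The relations of the Hopf envelope. -/
inductive EnvelopeRel :
    TensorAlgebra F (ℕ × Bool →₀ B) → TensorAlgebra F (ℕ × Bool →₀ B) → Prop
  | g_one (n : ℕ) : EnvelopeRel (envelopeGen F B (n, false) 1) 1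
  | g_mul (n : ℕ) (x y : B) : EnvelopeRel (envelopeGen F B (n, false) (x * y))
      (envelopeGen F B (n, false) x * envelopeGen F B (n, false) y)
  | h_one (n : ℕ) : EnvelopeRel (envelopeGen F B (n, true) 1) 1
  | h_mul (n : ℕ) (x y : B) : EnvelopeRel (envelopeGen F B (n, true) (x * y))
      (envelopeGen F B (n, true) y * envelopeGen F B (n, true) x)
  | inv_left (n : ℕ) (x : B) : EnvelopeRel (LinearMap.mul' F _ (TensorProduct.map
      (envelopeGen F B (n, false)) (envelopeGen F B (n, true)) (Coalgebra.comul x)))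
      (algebraMap F _ (Coalgebra.counit x))
  | inv_right (n : ℕ) (x : B) : EnvelopeRel (LinearMap.mul' F _ (TensorProduct.map
      (envelopeGen F B (n, true)) (envelopeGen F B (n, false)) (Coalgebra.comul x)))
      (algebraMap F _ (Coalgebra.counit x))
  | inv_op_left (n : ℕ) (x : B) : EnvelopeRel (LinearMap.mul' F _ (TensorProduct.map
      (envelopeGen F B (n + 1, false)) (envelopeGen F B (n, true))
        (TensorProduct.comm F B B (Coalgebra.comul x))))
      (algebraMap F _ (Coalgebra.counit x))
  | inv_op_right (n : ℕ) (x : B) : EnvelopeRel (LinearMap.mul' F _ (TensorProduct.map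
      (envelopeGen F B (n, true)) (envelopeGen F B (n + 1, false))
        (TensorProduct.comm F B B (Coalgebra.comul x))))
      (algebraMap F _ (Coalgebra.counit x))

/-- The Hopf envelope of a bialgebra `B`: the universal algebra with an antipode chain on `B`. -/
def HopfEnvelope : Type _ := RingQuot (EnvelopeRel F B)

noncomputable instance : Ring (HopfEnvelope F B) :=
  inferInstanceAs (Ring (RingQuot (EnvelopeRel F B)))

noncomputable instance : Algebra F (HopfEnvelope F B) :=
  inferInstanceAs (Algebra F (RingQuot (EnvelopeRel F B)))

namespace HopfEnvelope

/-- The quotient map from the tensor algebra. -/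
noncomputable def mk : TensorAlgebra F (ℕ × Bool →₀ B) →ₐ[F] HopfEnvelope F B :=
  RingQuot.mkAlgHom F (EnvelopeRel F B)

variable {F B} in
theorem mk_eq {x y : TensorAlgebra F (ℕ × Bool →₀ B)} (h : EnvelopeRel F B x y) :
    mk F B x = mk F B y :=
  RingQuot.mkAlgHom_rel F h

theorem mk_surjective : Function.Surjective (mk F B) :=
  RingQuot.mkAlgHom_surjective F (EnvelopeRel F B)

variable {F B} in
theorem hom_ext_mk {R : Type*} [Ring R] [Algebra F R] {f g : HopfEnvelope F B →ₐ[F] R}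
    (h : f.comp (mk F B) = g.comp (mk F B)) : f = g :=
  RingQuot.ringQuot_ext' F f g h

theorem exists_comp_mk_eq {R : Type*} [Ring R] [Algebra F R]
    (θ : TensorAlgebra F (ℕ × Bool →₀ B) →ₐ[F] R)
    (h : ∀ ⦃x y⦄, EnvelopeRel F B x y → θ x = θ y) :
    ∃ φ : HopfEnvelope F B →ₐ[F] R, φ.comp (mk F B) = θ :=
  ⟨RingQuot.liftAlgHom F ⟨θ, h⟩, AlgHom.ext (RingQuot.liftAlgHom_mkAlgHom_apply F θ h)⟩

theorem mk_mul'_map (k l : ℕ × Bool) (z : B ⊗[F] B) :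
    LinearMap.mul' F _ (TensorProduct.map ((mk F B).toLinearMap ∘ₗ envelopeGen F B k)
      ((mk F B).toLinearMap ∘ₗ envelopeGen F B l) z) =
    mk F B (LinearMap.mul' F _ (TensorProduct.map (envelopeGen F B k) (envelopeGen F B l) z)) :=
  mul'_map_comp _ _ _ _

/-- The universal antipode chain. -/
noncomputable def chain : AntipodeChain F B (HopfEnvelope F B) where
  g n := AlgHom.ofLinearMap ((mk F B).toLinearMap ∘ₗ envelopeGen F B (n, false))
    ((mk_eq (.g_one n)).trans (map_one _))
    fun x y => (mk_eq (.g_mul n x y)).trans (map_mul _ _ _)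
  h n := AlgHom.ofLinearMap (opLin F _ ∘ₗ (mk F B).toLinearMap ∘ₗ envelopeGen F B (n, true))
    (congrArg MulOpposite.op ((mk_eq (.h_one n)).trans (map_one _)))
    fun x y => congrArg MulOpposite.op ((mk_eq (.h_mul n x y)).trans (map_mul _ _ _))
  inv n := by
    constructor
    · exact toConv_mul_toConv_eq_one_iff.2 fun x => (mk_mul'_map F B _ _ _).trans
        ((mk_eq (.inv_left n x)).trans (AlgHom.commutes _ _))
    · exact toConv_mul_toConv_eq_one_iff.2 fun x => (mk_mul'_map F B _ _ _).trans
        ((mk_eq (.inv_right n x)).trans (AlgHom.commutes _ _))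
  inv_op n := by
    constructor
    · exact toConv_mul_toConv_op_eq_one_iff.2 fun x => (mk_mul'_map F B _ _ _).trans
        ((mk_eq (.inv_op_left n x)).trans (AlgHom.commutes _ _))
    · exact toConv_mul_toConv_op_eq_one_iff.2 fun x => (mk_mul'_map F B _ _ _).trans
        ((mk_eq (.inv_op_right n x)).trans (AlgHom.commutes _ _))

variable {F B}

@[elab_as_elim]
theorem induction {motive : HopfEnvelope F B → Prop}
    (algebraMap : ∀ c : F, motive (algebraMap F _ c))
    (add : ∀ x y, motive x → motive y → motive (x + y))
    (mul : ∀ x y, motive x → motive y → motive (x * y))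
    (g : ∀ n b, motive ((chain F B).g n b))
    (h : ∀ n b, motive ((chain F B).h n b).unop) (x : HopfEnvelope F B) : motive x := by
  obtain ⟨x, rfl⟩ := mk_surjective F B x
  induction x using TensorAlgebra.induction with
  | algebraMap r => simpa using algebraMap r
  | mul x y hx hy => simpa using mul _ _ hx hy
  | add x y hx hy => simpa using add _ _ hx hy
  | ι m =>
    induction m using Finsupp.induction_linear with
    | zero => simpa using algebraMap 0
    | add x y hx hy => simpa using add _ _ hx hy
    | single k b =>
      obtain ⟨n, _ | _⟩ := k
      · exact g n b
      · exact h n b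

variable {R : Type*} [Ring R] [Algebra F R]

/-- The two image chains share their first term, so they coincide; and the universal chain generates
the envelope. -/
theorem hom_ext {φ ψ : HopfEnvelope F B →ₐ[F] R}
    (h : φ.comp ((chain F B).g 0) = ψ.comp ((chain F B).g 0)) : φ = ψ := by
  have hc : (chain F B).map φ = (chain F B).map ψ := AntipodeChain.ext_zero h
  ext x
  induction x using induction with
  | algebraMap c => simp
  | add x y hx hy => simp [hx, hy]
  | mul x y hx hy => simp [hx, hy]
  | g n b => exact congrArg (fun c => c.g n b) hc
  | h n b => exact congrArg (fun c => (c.h n b).unop) hc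

theorem exists_hom (c : AntipodeChain F B R) :
    ∃ φ : HopfEnvelope F B →ₐ[F] R, (chain F B).map φ = c := by
  let θ₀ : (ℕ × Bool →₀ B) →ₗ[F] R := Finsupp.lsum F fun k : ℕ × Bool =>
    bif k.2 then unopLin F R ∘ₗ (c.h k.1).toLinearMap else (c.g k.1).toLinearMap
  let θ := TensorAlgebra.lift F θ₀
  have hg : ∀ n, θ.toLinearMap ∘ₗ envelopeGen F B (n, false) = (c.g n).toLinearMap := by
    intro n; ext b; simp [θ, θ₀, envelopeGen]
  have hh : ∀ n, θ.toLinearMap ∘ₗ envelopeGen F B (n, true) =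
      unopLin F R ∘ₗ (c.h n).toLinearMap := by
    intro n; ext b; simp [θ, θ₀, envelopeGen]
  have hg' : ∀ n b, θ (envelopeGen F B (n, false) b) = c.g n b :=
    fun n b => LinearMap.congr_fun (hg n) b
  have hh' : ∀ n b, θ (envelopeGen F B (n, true) b) = (c.h n b).unop :=
    fun n b => LinearMap.congr_fun (hh n) b
  have hrel : ∀ ⦃x y⦄, EnvelopeRel F B x y → θ x = θ y := by
    intro x y hxy
    induction hxy with
    | g_one n => simp [hg']
    | g_mul n x y => simp [hg']
    | h_one n => simp [hh']
    | h_mul n x y => simp [hh']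
    | inv_left n x =>
      rw [← mul'_map_comp, hg, hh, AlgHom.commutes]
      exact toConv_mul_toConv_eq_one_iff.1 (c.inv n).1 x
    | inv_right n x =>
      rw [← mul'_map_comp, hg, hh, AlgHom.commutes]
      exact toConv_mul_toConv_eq_one_iff.1 (c.inv n).2 x
    | inv_op_left n x =>
      rw [← mul'_map_comp, hg, hh, AlgHom.commutes]
      exact toConv_mul_toConv_op_eq_one_iff.1 (c.inv_op n).1 x
    | inv_op_right n x =>
      rw [← mul'_map_comp, hg, hh, AlgHom.commutes]
      exact toConv_mul_toConv_op_eq_one_iff.1 (c.inv_op n).2 x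
  obtain ⟨φ, hφ⟩ := exists_comp_mk_eq F B θ hrel
  refine ⟨φ, AntipodeChain.ext_zero (AlgHom.ext fun b => ?_)⟩
  exact (AlgHom.congr_fun hφ _).trans (hg' 0 b)

/-- The algebra homomorphism that corresponds to an antipode chain. -/
noncomputable def lift (c : AntipodeChain F B R) : HopfEnvelope F B →ₐ[F] R :=
  (exists_hom c).choose

theorem map_lift (c : AntipodeChain F B R) : (chain F B).map (lift c) = c :=
  (exists_hom c).choose_spec

theorem lift_g (c : AntipodeChain F B R) (n : ℕ) (b : B) :
    lift c ((chain F B).g n b) = c.g n b :=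
  congrArg (fun c : AntipodeChain F B R => c.g n b) (map_lift c)

theorem lift_h (c : AntipodeChain F B R) (n : ℕ) (b : B) :
    lift c ((chain F B).h n b).unop = (c.h n b).unop :=
  congrArg (fun c : AntipodeChain F B R => (c.h n b).unop) (map_lift c)

variable (F B) in
/-- The comultiplication of the Hopf envelope. -/
noncomputable def comulAlgHom : HopfEnvelope F B →ₐ[F] HopfEnvelope F B ⊗[F] HopfEnvelope F B :=
  lift ((chain F B).tmul (chain F B))

variable (F B) in
/-- The counit of the Hopf envelope. -/
noncomputable def counitAlgHom : HopfEnvelope F B →ₐ[F] F :=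
  lift (AntipodeChain.counit F B)

theorem comulAlgHom_g (n : ℕ) (b : B) : comulAlgHom F B ((chain F B).g n b) =
    TensorProduct.map ((chain F B).g n).toLinearMap ((chain F B).g n).toLinearMap
      (Coalgebra.comul b) :=
  lift_g _ n b

theorem comulAlgHom_h (n : ℕ) (b : B) : comulAlgHom F B ((chain F B).h n b).unop =
    TensorProduct.map (unopLin F _ ∘ₗ ((chain F B).h n).toLinearMap)
      (unopLin F _ ∘ₗ ((chain F B).h n).toLinearMap)
      (TensorProduct.comm F B B (Coalgebra.comul b)) := by
  rw [TensorProduct.map_comp]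
  exact lift_h _ n b

theorem counitAlgHom_g (n : ℕ) (b : B) :
    counitAlgHom F B ((chain F B).g n b) = Coalgebra.counit b :=
  lift_g _ n b

theorem counitAlgHom_h (n : ℕ) (b : B) :
    counitAlgHom F B ((chain F B).h n b).unop = Coalgebra.counit b :=
  lift_h _ n b

theorem comulAlgHom_rTensor_g (z : B ⊗[F] B) (n : ℕ) :
    TensorProduct.assoc F _ _ _ (TensorProduct.map (comulAlgHom F B).toLinearMap LinearMap.id
      (TensorProduct.map ((chain F B).g n).toLinearMap ((chain F B).g n).toLinearMap z)) =
    TensorProduct.map ((chain F B).g n).toLinearMap (TensorProduct.map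
      ((chain F B).g n).toLinearMap ((chain F B).g n).toLinearMap)
      (TensorProduct.assoc F _ _ _ (Coalgebra.comul.rTensor B z)) := by
  induction z with
  | zero => simp
  | add x y hx hy => simp only [map_add, hx, hy]
  | tmul x y =>
    simp only [TensorProduct.map_tmul, AlgHom.toLinearMap_apply, comulAlgHom_g,
      LinearMap.rTensor_tmul]
    induction Coalgebra.comul (R := F) x with
    | zero => simp
    | add x y hx hy => simp only [map_add, TensorProduct.add_tmul, hx, hy]
    | tmul x y => simp

theorem comulAlgHom_lTensor_g (z : B ⊗[F] B) (n : ℕ) :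
    TensorProduct.map LinearMap.id (comulAlgHom F B).toLinearMap
      (TensorProduct.map ((chain F B).g n).toLinearMap ((chain F B).g n).toLinearMap z) =
    TensorProduct.map ((chain F B).g n).toLinearMap (TensorProduct.map
      ((chain F B).g n).toLinearMap ((chain F B).g n).toLinearMap)
      (Coalgebra.comul.lTensor B z) := by
  induction z with
  | zero => simp
  | add x y hx hy => simp only [map_add, hx, hy]
  | tmul x y =>
    simp only [TensorProduct.map_tmul, AlgHom.toLinearMap_apply, comulAlgHom_g,
      LinearMap.lTensor_tmul, LinearMap.id_apply]

theorem counitAlgHom_rTensor_g (z : B ⊗[F] B) (n : ℕ) :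
    TensorProduct.map (counitAlgHom F B).toLinearMap LinearMap.id
      (TensorProduct.map ((chain F B).g n).toLinearMap ((chain F B).g n).toLinearMap z) =
    ((chain F B).g n).toLinearMap.lTensor F (Coalgebra.counit.rTensor B z) := by
  induction z with
  | zero => simp
  | add x y hx hy => simp only [map_add, hx, hy]
  | tmul x y => simp [counitAlgHom_g]

theorem counitAlgHom_lTensor_g (z : B ⊗[F] B) (n : ℕ) :
    TensorProduct.map LinearMap.id (counitAlgHom F B).toLinearMap
      (TensorProduct.map ((chain F B).g n).toLinearMap ((chain F B).g n).toLinearMap z) =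
    ((chain F B).g n).toLinearMap.rTensor F (Coalgebra.counit.lTensor B z) := by
  induction z with
  | zero => simp
  | add x y hx hy => simp only [map_add, hx, hy]
  | tmul x y => simp [counitAlgHom_g]

/-- The axioms are equalities of algebra homomorphisms, so it suffices to check them on the image of
`g 0`, where they reduce to the axioms of `B`. -/
noncomputable instance : Bialgebra F (HopfEnvelope F B) :=
  Bialgebra.ofAlgHom (comulAlgHom F B) (counitAlgHom F B)
    (by
      refine hom_ext (AlgHom.ext fun b => ?_)
      have h1 := comulAlgHom_rTensor_g (F := F) (Coalgebra.comul b) 0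
      rw [Coalgebra.coassoc_apply, ← comulAlgHom_lTensor_g, ← comulAlgHom_g] at h1
      exact h1)
    (by
      refine hom_ext (AlgHom.ext fun b => ?_)
      have h1 := counitAlgHom_rTensor_g (F := F) (Coalgebra.comul b) 0
      rw [Coalgebra.rTensor_counit_comul, ← comulAlgHom_g] at h1
      exact h1)
    (by
      refine hom_ext (AlgHom.ext fun b => ?_)
      have h1 := counitAlgHom_lTensor_g (F := F) (Coalgebra.comul b) 0
      rw [Coalgebra.lTensor_counit_comul, ← comulAlgHom_g] at h1
      exact h1)

variable (F B) in
/-- The antipode, as a homomorphism to the opposite algebra. -/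
noncomputable def antipodeAlgHom : HopfEnvelope F B →ₐ[F] (HopfEnvelope F B)ᵐᵒᵖ :=
  lift (chain F B).shift

variable (F B) in
/-- The antipode, as a linear map. -/
noncomputable def antipodeLin : HopfEnvelope F B →ₗ[F] HopfEnvelope F B :=
  unopLin F _ ∘ₗ (antipodeAlgHom F B).toLinearMap

theorem antipodeLin_mul (x y : HopfEnvelope F B) :
    antipodeLin F B (x * y) = antipodeLin F B y * antipodeLin F B x := by
  simp [antipodeLin]

/-- The antipode moves one step along the chain: from `g n` to `h n`, and then to `g (n + 1)`. -/
theorem antipodeLin_comp_g (n : ℕ) : antipodeLin F B ∘ₗ ((chain F B).g n).toLinearMap =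
    unopLin F _ ∘ₗ ((chain F B).h n).toLinearMap :=
  LinearMap.ext fun b => congrArg MulOpposite.unop (lift_g (chain F B).shift n b)

theorem antipodeLin_comp_h (n : ℕ) :
    antipodeLin F B ∘ₗ (unopLin F _ ∘ₗ ((chain F B).h n).toLinearMap) =
      ((chain F B).g (n + 1)).toLinearMap :=
  LinearMap.ext fun b => congrArg MulOpposite.unop (lift_h (chain F B).shift n b)

theorem mul'_map_antipodeLin_left (z : HopfEnvelope F B ⊗[F] HopfEnvelope F B)
    (x y : HopfEnvelope F B) :
    LinearMap.mul' F _ ((antipodeLin F B).rTensor _ (z * x ⊗ₜ y)) =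
      antipodeLin F B x * LinearMap.mul' F _ ((antipodeLin F B).rTensor _ z) * y := by
  induction z with
  | zero => simp
  | add x y hx hy => simp only [map_add, add_mul, mul_add, hx, hy]
  | tmul a b => simp [antipodeLin_mul, mul_assoc]

theorem mul'_map_antipodeLin_right (z : HopfEnvelope F B ⊗[F] HopfEnvelope F B)
    (x y : HopfEnvelope F B) :
    LinearMap.mul' F _ ((antipodeLin F B).lTensor _ (x ⊗ₜ y * z)) =
      x * LinearMap.mul' F _ ((antipodeLin F B).lTensor _ z) * antipodeLin F B y := by
  induction z with
  | zero => simp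
  | add x y hx hy => simp only [map_add, add_mul, mul_add, hx, hy]
  | tmul a b => simp [antipodeLin_mul, mul_assoc]

/-- The left side is not multiplicative in `x`, so `hom_ext` does not apply. Anti-multiplicativity
of the antipode passes the identity from two factors to their product, and on the generators it is
one half of `inv` or `inv_op`. -/
theorem mul'_antipodeLin_comul (x : HopfEnvelope F B) :
    LinearMap.mul' F _ ((antipodeLin F B).rTensor _ (comulAlgHom F B x)) =
      algebraMap F _ (counitAlgHom F B x) := by
  induction x using induction with
  | algebraMap c => simp [antipodeLin, Algebra.TensorProduct.algebraMap_apply]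
  | add x y hx hy => simp only [map_add, hx, hy]
  | mul x y hx hy =>
    rw [map_mul (comulAlgHom F B), map_mul (counitAlgHom F B), map_mul (algebraMap F _), ← hy]
    induction comulAlgHom F B y with
    | zero => simp
    | add y z hy hz => simp only [map_add, mul_add, hy, hz]
    | tmul a b =>
      -- The inner sum over `Δ x` collapses to the scalar `ε(x)`, which is central and can be moved
      -- out.
      rw [mul'_map_antipodeLin_left, hx, LinearMap.rTensor_tmul, LinearMap.mul'_apply,
        ← Algebra.commutes, mul_assoc]
  | g n b =>
    rw [comulAlgHom_g, counitAlgHom_g, LinearMap.rTensor,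
      ← LinearMap.comp_apply (TensorProduct.map _ _), ← TensorProduct.map_comp,
      antipodeLin_comp_g, LinearMap.id_comp]
    exact toConv_mul_toConv_eq_one_iff.1 ((chain F B).inv n).2 b
  | h n b =>
    rw [comulAlgHom_h, counitAlgHom_h, LinearMap.rTensor,
      ← LinearMap.comp_apply (TensorProduct.map _ _), ← TensorProduct.map_comp,
      antipodeLin_comp_h, LinearMap.id_comp]
    exact toConv_mul_toConv_op_eq_one_iff.1 ((chain F B).inv_op n).1 b

theorem mul'_comul_antipodeLin (x : HopfEnvelope F B) :
    LinearMap.mul' F _ ((antipodeLin F B).lTensor _ (comulAlgHom F B x)) =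
      algebraMap F _ (counitAlgHom F B x) := by
  induction x using induction with
  | algebraMap c => simp [antipodeLin, Algebra.TensorProduct.algebraMap_apply]
  | add x y hx hy => simp only [map_add, hx, hy]
  | mul x y hx hy =>
    rw [map_mul (comulAlgHom F B), map_mul (counitAlgHom F B), map_mul (algebraMap F _), ← hx]
    induction comulAlgHom F B x with
    | zero => simp
    | add y z hy hz => simp only [map_add, add_mul, hy, hz]
    | tmul a b =>
      rw [mul'_map_antipodeLin_right, hy, LinearMap.lTensor_tmul, LinearMap.mul'_apply,
        mul_assoc, Algebra.commutes, ← mul_assoc]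
  | g n b =>
    rw [comulAlgHom_g, counitAlgHom_g, LinearMap.lTensor,
      ← LinearMap.comp_apply (TensorProduct.map _ _), ← TensorProduct.map_comp,
      antipodeLin_comp_g, LinearMap.id_comp]
    exact toConv_mul_toConv_eq_one_iff.1 ((chain F B).inv n).1 b
  | h n b =>
    rw [comulAlgHom_h, counitAlgHom_h, LinearMap.lTensor,
      ← LinearMap.comp_apply (TensorProduct.map _ _), ← TensorProduct.map_comp,
      antipodeLin_comp_h, LinearMap.id_comp]
    exact toConv_mul_toConv_op_eq_one_iff.1 ((chain F B).inv_op n).2 b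

noncomputable instance : HopfAlgebra F (HopfEnvelope F B) where
  antipode := antipodeLin F B
  mul_antipode_rTensor_comul := LinearMap.ext mul'_antipodeLin_comul
  mul_antipode_lTensor_comul := LinearMap.ext mul'_comul_antipodeLin

variable (F B) in
/-- The canonical bialgebra homomorphism from `B` to its Hopf envelope. -/
noncomputable def of : B →ₐc[F] HopfEnvelope F B :=
  BialgHom.ofAlgHom ((chain F B).g 0) (AlgHom.ext fun b => counitAlgHom_g 0 b)
    (AlgHom.ext fun b => (comulAlgHom_g 0 b).symm)

end HopfEnvelope

end HopfEnvelope

/-! ### The universal property of the Hopf envelope. -/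

section ChainOfHopfAlgebra

variable {F : Type*} [Field F] {B H : Type*} [Ring B] [Bialgebra F B] [Ring H] [HopfAlgebra F H]

variable (F H) in
/-- The square of the antipode, as an algebra homomorphism. -/
noncomputable def antipodeSqAlgHom : H →ₐ[F] H :=
  (AlgEquiv.opOp F H).symm.toAlgHom.comp ((AlgHom.op (HopfAlgebra.antipodeAlgHomOp F H)).comp
    (HopfAlgebra.antipodeAlgHomOp F H))

/-- The antipode is the convolution inverse of the identity, and convolution inverses pull back
along coalgebra maps. -/
theorem isConvInverse_antipode (φ : B →ₐc[F] H) :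
    IsConvInverse (φ : B →ₗ[F] H) (unopLin F H ∘ₗ
      (HopfAlgebra.antipodeAlgHomOp F H).toLinearMap ∘ₗ (φ : B →ₗ[F] H)) := by
  have h : IsConvInverse (LinearMap.id : H →ₗ[F] H) (HopfAlgebra.antipode F) :=
    ⟨LinearMap.id_mul_antipode, LinearMap.antipode_mul_id⟩
  exact (h.comp_coalgHom (φ : B →ₗc[F] H)).congr (fun _ => rfl) fun _ => rfl

/-- The antipode chain `φ, S φ, S² φ, …` of a bialgebra homomorphism `φ` to a Hopf algebra. -/
noncomputable def BialgHom.antipodeChain (φ : B →ₐc[F] H) : AntipodeChain F B H where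
  g n := (antipodeSqAlgHom F H ^ n).comp (φ : B →ₐ[F] H)
  h n := (AlgHom.op (antipodeSqAlgHom F H ^ n)).comp
    ((HopfAlgebra.antipodeAlgHomOp F H).comp (φ : B →ₐ[F] H))
  inv n := (isConvInverse_antipode φ).algHom_comp (antipodeSqAlgHom F H ^ n)
  inv_op n := by
    -- With `T` the squared antipode, `T ^ (n + 1)` is split as `T ^ n` after `T`; the claim is then
    -- the basic inverse pair pushed forward along the antipode followed by `T ^ n`.
    rw [pow_succ]
    exact (isConvInverse_antipode φ).algHom_comp ((AlgHom.op (antipodeSqAlgHom F H ^ n)).comp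
      (HopfAlgebra.antipodeAlgHomOp F H))

theorem HopfEnvelope.bialgHom_ext {φ ψ : HopfEnvelope F B →ₐc[F] H}
    (h : ∀ b, φ (of F B b) = ψ (of F B b)) : φ = ψ := by
  have : (φ : HopfEnvelope F B →ₐ[F] H) = (ψ : HopfEnvelope F B →ₐ[F] H) :=
    hom_ext (AlgHom.ext h)
  ext x
  exact AlgHom.congr_fun this x

theorem HopfEnvelope.exists_bialgHom (φ : B →ₐc[F] H) :
    ∃ ψ : HopfEnvelope F B →ₐc[F] H, ∀ b, ψ (of F B b) = φ b := by
  have hψ : ∀ b, lift φ.antipodeChain ((chain F B).g 0 b) = φ b := lift_g φ.antipodeChain 0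
  refine ⟨BialgHom.ofAlgHom (lift φ.antipodeChain) (hom_ext (AlgHom.ext fun b => ?_))
    (hom_ext (AlgHom.ext fun b => ?_)), hψ⟩
  · refine (congrArg Coalgebra.counit (hψ b)).trans (Eq.trans ?_ (counitAlgHom_g 0 b).symm)
    exact LinearMap.congr_fun (CoalgHomClass.counit_comp φ) b
  · refine Eq.trans ?_ (congrArg (Coalgebra.comul (R := F)) (hψ b)).symm
    refine Eq.trans (congrArg (Algebra.TensorProduct.map (lift φ.antipodeChain)
      (lift φ.antipodeChain)) (comulAlgHom_g 0 b)) (Eq.trans ?_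
      (LinearMap.congr_fun (CoalgHomClass.map_comp_comul φ) b))
    rw [LinearMap.comp_apply]
    induction Coalgebra.comul (R := F) b with
    | zero => simp
    | add x y hx hy => simp only [map_add, hx, hy]
    | tmul x y => simp [hψ]

end ChainOfHopfAlgebra

/-! ### The criterion for Hopf algebras. -/

section UniversalHopf

variable {F : Type u} [Field F] {Ω : Type w} {s t : Ω → ℕ} {A : Type v} [AddCommGroup A]
  [Module F A] {S : OmegaAlgebra F s t A} {V W : Subalgebra F (Module.End F A)}

/-- A coaction of a Hopf algebra factors through the universal bialgebra, and the resulting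
bialgebra map extends to the Hopf envelope. For uniqueness, both universal properties are used in
turn. -/
theorem UniversalCoactingBialgebraExists.hopf (h : UniversalCoactingBialgebraExists S W) :
    UniversalCoactingHopfAlgebraExists S W := by
  obtain ⟨B, _, _, ρ, hρ⟩ := h
  refine ⟨HopfEnvelope F B, inferInstance, inferInstance,
    (HopfEnvelope.of F B : B →ₗ[F] HopfEnvelope F B).lTensor A ∘ₗ ρ,
    hρ.isCoaction.lTensor_comp _, (cosupport_lTensor_comp_le _ _).trans hρ.cosupport_le,
    fun H' _ _ ρ' hρ' hsupp => ?_⟩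
  obtain ⟨φ, hφ, huniq⟩ := hρ.universal H' ρ' hρ' hsupp
  have hcomp : ∀ ψ : HopfEnvelope F B →ₐc[F] H',
      (ψ : HopfEnvelope F B →ₗ[F] H').lTensor A ∘ₗ
        ((HopfEnvelope.of F B : B →ₗ[F] HopfEnvelope F B).lTensor A ∘ₗ ρ) =
      ((ψ : HopfEnvelope F B →ₐ[F] H').comp
        (HopfEnvelope.of F B : B →ₐ[F] HopfEnvelope F B)).toLinearMap.lTensor A ∘ₗ ρ := by
    intro ψ
    rw [← LinearMap.comp_assoc, ← LinearMap.lTensor_comp]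
    rfl
  obtain ⟨ψ, hψ⟩ := HopfEnvelope.exists_bialgHom φ
  refine ⟨ψ, ?_, fun ψ' hψ' => HopfEnvelope.bialgHom_ext fun b => ?_⟩
  · dsimp only
    rw [hcomp, ← hφ]
    congr 2
    exact LinearMap.ext hψ
  · rw [hψ]
    dsimp only at hψ'
    rw [hcomp] at hψ'
    exact AlgHom.congr_fun (huniq _ hψ') b

/-- The hypothesis does not bound general bialgebra coactions with cosupport in `V`. So the
universal bialgebra is formed for the finite closure of `hopfCosupportAlgebra S V`, which still
contains the cosupport of every relevant Hopf coaction, and only then is the envelope taken. -/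
theorem universalCoactingHopfAlgebraExists_iff (hV : IsFinitelyClosed V) :
    UniversalCoactingHopfAlgebraExists S V ↔
      PointwiseFiniteDimensional (Subalgebra.toSubmodule (hopfCosupportAlgebra S V)) := by
  refine ⟨fun h => h.pointwiseFiniteDimensional, fun h => ?_⟩
  obtain ⟨H, _, _, ρ, hρ⟩ := (exists_isUniversalBialgebraCoaction (S := S)
    isFinitelyClosed_finiteClosure (pointwiseFiniteDimensional_finiteClosure h)).hopf
  refine ⟨H, _, _, ρ, hρ.isCoaction,
    hρ.cosupport_le.trans (finiteClosure_le hV hopfCosupportAlgebra_le),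
    fun H' _ _ ρ' hρ' hsupp => hρ.universal H' ρ' hρ' fun f hf => le_finiteClosure ?_⟩
  exact Algebra.subset_adjoin ⟨H', _, _, ρ', hρ', hsupp, hf⟩

end UniversalHopf

theorem mainTheorem2 {F : Type u} [Field F] {Ω : Type w} {s t : Ω → ℕ} {A : Type v}
    [AddCommGroup A] [Module F A] (S : OmegaAlgebra F s t A)
    (V : Subalgebra F (Module.End F A))
    (hV : IsClosed[finiteTopology F A A] (V : Set (Module.End F A))) :
    (UniversalCoactingBialgebraExists S V ↔
      PointwiseFiniteDimensional (Subalgebra.toSubmodule (bialgebraCosupportAlgebra S V))) ∧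
    (UniversalCoactingHopfAlgebraExists S V ↔
      PointwiseFiniteDimensional (Subalgebra.toSubmodule (hopfCosupportAlgebra S V))) :=
  have hV' := isFinitelyClosed_of_isClosed V hV
  ⟨universalCoactingBialgebraExists_iff hV', universalCoactingHopfAlgebraExists_iff hV'⟩
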